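/- \textbf{Corollary (Limiting vertex distribution).} For a finite simple graph $G$ with at least one vertex, let its barycentric refinement be the graph whose vertices are the nonempty complete subgraphs of $G$, two distinct ones being adjacent if one is contained in the other. Let $G_0=G$ and let $G_{m+1}$ be the barycentric refinement of $G_m$. For a graph $\Gamma$ with $n$ vertices let $d_0\le d_1\le\dots\le d_{n-1}$ be its vertex degrees and $\lambda_0\le\lambda_1\le\dots\le\lambda_{n-1}$ the eigenvalues of its Laplacian $L=B-A$ ($B$ the diagonal degree matrix, $A$ the adjacency matrix), both with multiplicity, and define on $[0,1]$ $$H_\Gamma(x)=d_{[nx]},\qquad F_\Gamma(x)=\lambda_{[nx]},$$ where $[r]$ is the integer part of $r$ and where at $x=1$ the largest values $d_{n-1}$ and $\lambda_{n-1}$ are taken. For every integer $d\ge 0$ there are functions $F=F_d$ and $H=H_d$ in $L^1([0,1])$, depending only on $d$, with $H$ nondecreasing on $(0,1)$, such that for every finite simple graph $G$ whose largest complete subgraph has dimension $d$ (that is, has $d+1$ vertices), as $m\to\infty$, $$F_{G_m}\to F\quad\text{and}\quad H_{G_m}\to H\quad\text{in } L^1([0,1]),$$ and $H_{G_m}(x)\to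 H(x)$ at every point $x\in(0,1)$ at which $H$ is continuous. Moreover, the integrated vertex degree function bounds the integrated eigenvalue function from above and agrees with it at the end points: $$\int_0^x H(t)\,dt\ \ge\ \int_0^x F(t)\,dt\quad\text{for all } x\in[0,1],$$ with equality at $x=0$ and at $x=1$. -/

import Mathlib

open MeasureTheory Filter Set Topology

universe u

/-- A finite simple graph together with its vertex type. -/
structure FinGraph where
  V : Type u
  [fintypeV : Fintype V]
  graph : SimpleGraph V

attribute [instance] FinGraph.fintypeV

namespace FinGraph

/-- The vertices of the barycentric refinement: the (nonempty) complete subgraphs of `G`,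
given by their vertex sets. -/
def Simplex (G : FinGraph.{u}) : Type u :=
  {s : Finset G.V // s.Nonempty ∧ G.graph.IsClique (s : Set G.V)}

open Classical in
noncomputable instance simplexFintype (G : FinGraph.{u}) : Fintype G.Simplex :=
  inferInstanceAs
    (Fintype {s : Finset G.V // s.Nonempty ∧ G.graph.IsClique (s : Set G.V)})

/-- The barycentric refinement: two distinct complete subgraphs are adjacent if one of them
is contained in the other. -/
noncomputable def barycentric (G : FinGraph.{u}) : FinGraph.{u} where
  V := G.Simplex
  graph :=
    { Adj := fun s t => s ≠ t ∧ (s.1 ⊆ t.1 ∨ t.1 ⊆ s.1)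
      symm := ⟨fun _ _ h => ⟨h.1.symm, h.2.symm⟩⟩
      loopless := ⟨fun _ h => h.1 rfl⟩ }

/-- The `m`-th barycentric refinement `G_m`, with `G_0 = G`. -/
noncomputable def refinement (G : FinGraph.{u}) (m : ℕ) : FinGraph.{u} :=
  barycentric^[m] G

open Classical in
/-- The eigenvalues, with multiplicity, of the Laplacian (degree matrix minus adjacency
matrix) of `G`. -/
noncomputable def laplaceEigenvalues (G : FinGraph.{u}) : Multiset ℝ :=
  (Finset.univ : Finset G.V).val.map
    ((G.graph.posSemidef_lapMatrix ℝ).isHermitian.eigenvalues)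

open Classical in
/-- The vertex degrees, with multiplicity, of `G`. -/
noncomputable def vertexDegrees (G : FinGraph.{u}) : Multiset ℝ :=
  (Finset.univ : Finset G.V).val.map (fun v => (G.graph.degree v : ℝ))

/-- For a multiset with elements `a_0 ≤ a_1 ≤ ⋯ ≤ a_{n-1}`, the function
`x ↦ a_{⌊n x⌋}` on `[0,1]`, where at `x = 1` the value is the largest element `a_{n-1}`. -/
noncomputable def orderedFunction (s : Multiset ℝ) (x : ℝ) : ℝ :=
  (s.sort (· ≤ ·)).getD (min ⌊(s.card : ℝ) * x⌋₊ (s.card - 1)) 0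

/-- The spectral function `F_G(x) = λ_{⌊n x⌋}`. -/
noncomputable def spectralFunction (G : FinGraph.{u}) : ℝ → ℝ :=
  orderedFunction G.laplaceEigenvalues

/-- The degree distribution function `H_G(x) = d_{⌊n x⌋}`. -/
noncomputable def degreeFunction (G : FinGraph.{u}) : ℝ → ℝ :=
  orderedFunction G.vertexDegrees

end FinGraph

/-- The sequence `f m` converges to `g` in `L¹([0,1])`. -/
def ConvergesInL1 (f : ℕ → ℝ → ℝ) (g : ℝ → ℝ) : Prop :=
  (∀ m, IntegrableOn (f m) (Icc 0 1)) ∧ IntegrableOn g (Icc 0 1) ∧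
    Tendsto (fun m => eLpNorm (f m - g) 1 (volume.restrict (Icc 0 1))) atTop (𝓝 0)

/-! Degrees and Laplacian eigenvalues are handled together through the properties in
`IsEdgeMonotone`: one nonnegative number per vertex, total twice the number of edges, stochastic
increase when edges are added, additivity over disjoint unions. If one multiset stochastically
dominates another, their ordered functions are comparable pointwise, so their L¹ distance is a
difference of means. Hence deleting few edges or adding few isolated vertices changes the ordered
function little (`integral_abs_sub_le_of_blocks`).

Every vertex of `G_k` has a support in `G`, a clique as soon as `k ≥ 1`. The vertices supported on a
given clique with `d + 1` vertices (a facet) span a copy of `interior d k`, which depends only on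
`d` and `k`, and copies for different facets are not joined. Deleting the edges at all other
vertices therefore leaves disjoint copies of `interior d k` and isolated points. What is lost is
negligible: each refinement multiplies the number of facets by at least `(d+1)!`, but a weighted
number of simplices touching the other vertices by at most `(d+1)! - 1/2`, because after the first
refinement every facet has a vertex of full support, so not all of its `(d+1)!` flags start at a bad
vertex (`touchWeight_barycentric_le`). So `G_k` and `interior d k` approach each other geometrically
in L¹. Used for the simplex and for its refinement, this makes the functions of `interior d k` a
Cauchy sequence, whose limit serves every `G`.

The inequality of integrals is Schur majorization: the degrees are the diagonal of the Laplacian,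
and `∫₀ˣ` of an ordered function is the supremum over `c` of `c x` minus the mean of `(c - a)⁺`. It
passes to the limit, with equality at `1` from the trace. An L¹ limit of monotone functions has a
monotone representative, and monotonicity upgrades L¹ convergence to convergence at continuity
points. -/

namespace FinGraph

/-! ### Ordered functions of multisets, stochastic dominance and majorization -/

theorem getElem_le_iff_lt_countP {l : List ℝ} (hl : l.Pairwise (· ≤ ·)) (c : ℝ) (i : ℕ)
    (hi : i < l.length) : l[i] ≤ c ↔ i < l.countP (fun a => decide (a ≤ c)) := by
  constructor
  · intro h
    have h1 : (l.take (i + 1)).countP (fun a => decide (a ≤ c)) = (l.take (i + 1)).length := by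
      rw [List.countP_eq_length]
      intro a ha
      obtain ⟨j, hj, rfl⟩ := List.getElem_of_mem ha
      simp only [List.length_take] at hj
      simp only [List.getElem_take, decide_eq_true_eq]
      refine le_trans ?_ h
      rcases Nat.lt_or_ge j i with hji | hji
      · exact List.pairwise_iff_getElem.1 hl _ _ _ _ hji
      · have : j = i := by omega
        subst this; exact le_rfl
    have h2 := (List.take_sublist (i + 1) l).countP_le (p := fun a => decide (a ≤ c))
    rw [h1, List.length_take] at h2
    omega
  · intro h
    by_contra hc
    have h1 : (l.drop i).countP (fun a => decide (a ≤ c)) = 0 := by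
      rw [List.countP_eq_zero]
      intro a ha
      obtain ⟨j, hj, rfl⟩ := List.getElem_of_mem ha
      simp only [List.getElem_drop, decide_eq_true_eq, not_le]
      refine lt_of_lt_of_le (not_le.1 hc) ?_
      rcases Nat.eq_zero_or_pos j with hj0 | hj0
      · subst hj0; simp
      · exact List.pairwise_iff_getElem.1 hl _ _ _ _ (by omega)
    have h2 : l.countP (fun a => decide (a ≤ c)) =
        (l.take i).countP (fun a => decide (a ≤ c)) +
          (l.drop i).countP (fun a => decide (a ≤ c)) := by
      rw [← List.countP_append, List.take_append_drop]
    have h3 : (l.take i).countP (fun a => decide (a ≤ c)) ≤ (l.take i).length :=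
      List.countP_le_length
    rw [List.length_take] at h3
    omega

/-- The adjunction between quantile function and distribution function, which turns statements on
sorted lists into counts. The point `x = 1` is excluded: there the right side is always false. -/
theorem orderedFunction_le_iff {s : Multiset ℝ} (hs : s ≠ 0) {x : ℝ} (hx0 : 0 ≤ x) (hx1 : x < 1)
    (c : ℝ) : orderedFunction s x ≤ c ↔ (s.card : ℝ) * x < s.countP (· ≤ c) := by
  have hn : 0 < s.card := Multiset.card_pos.2 hs
  have hn' : (0 : ℝ) < s.card := by exact_mod_cast hn
  have hfl : ⌊(s.card : ℝ) * x⌋₊ < s.card := by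
    rw [Nat.floor_lt (by positivity)]
    nlinarith
  have hmin : min ⌊(s.card : ℝ) * x⌋₊ (s.card - 1) = ⌊(s.card : ℝ) * x⌋₊ := by omega
  have hlen : ⌊(s.card : ℝ) * x⌋₊ < (s.sort (· ≤ ·)).length := by simpa using hfl
  rw [orderedFunction, hmin, List.getD_eq_getElem _ _ hlen,
    getElem_le_iff_lt_countP (Multiset.pairwise_sort s (· ≤ ·)) c _ hlen,
    Nat.floor_lt (by positivity)]
  have : s.countP (· ≤ c) = (s.sort (· ≤ ·)).countP (fun a => decide (a ≤ c)) := by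
    conv_lhs => rw [← Multiset.sort_eq s (· ≤ ·)]
    rw [Multiset.coe_countP]
  rw [this]

theorem orderedFunction_mono {s : Multiset ℝ} (hs : s ≠ 0) :
    MonotoneOn (orderedFunction s) (Ico 0 1) := by
  intro x hx y hy hxy
  rw [orderedFunction_le_iff hs hx.1 hx.2]
  have := (orderedFunction_le_iff hs hy.1 hy.2 (orderedFunction s y)).1 le_rfl
  refine lt_of_le_of_lt ?_ this
  gcongr

/-- Stochastic dominance of multisets gives pointwise inequality of the ordered functions. -/
theorem orderedFunction_le_of_countP {s t : Multiset ℝ} (hs : s ≠ 0) (ht : t ≠ 0)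
    (h : ∀ c : ℝ, t.countP (· ≤ c) * s.card ≤ s.countP (· ≤ c) * t.card)
    {x : ℝ} (hx0 : 0 ≤ x) (hx1 : x < 1) : orderedFunction s x ≤ orderedFunction t x := by
  rw [orderedFunction_le_iff hs hx0 hx1]
  have h1 := (orderedFunction_le_iff ht hx0 hx1 (orderedFunction t x)).1 le_rfl
  have h2 : ((t.countP (· ≤ orderedFunction t x) * s.card : ℕ) : ℝ) ≤
    ((s.countP (· ≤ orderedFunction t x) * t.card : ℕ) : ℝ) := by exact_mod_cast h _
  push_cast at h2
  have hs' : (0 : ℝ) < s.card := by exact_mod_cast Multiset.card_pos.2 hs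
  have ht' : (0 : ℝ) < t.card := by exact_mod_cast Multiset.card_pos.2 ht
  by_contra hcon
  push Not at hcon
  have h3 := mul_lt_mul_of_pos_right h1 hs'
  have h4 := mul_le_mul_of_nonneg_right hcon ht'.le
  linarith [mul_right_comm (s.card : ℝ) x t.card, mul_comm (s.card : ℝ) t.card,
    mul_right_comm (t.card : ℝ) x s.card, congrArg (· * x) (mul_comm (s.card : ℝ) t.card)]

theorem measurable_comp_orderedFunction (s : Multiset ℝ) (f : ℝ → ℝ) :
    Measurable (fun x => f (orderedFunction s x)) := by
  have h : Measurable (fun x : ℝ => ⌊(s.card : ℝ) * x⌋₊) :=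
    Nat.measurable_floor.comp (measurable_const_mul _)
  exact (measurable_from_nat (f := fun k : ℕ =>
    f ((s.sort (· ≤ ·)).getD (min k (s.card - 1)) 0))).comp h

theorem integrableOn_comp_orderedFunction (s : Multiset ℝ) (f : ℝ → ℝ) (a b : ℝ) :
    IntegrableOn (fun x => f (orderedFunction s x)) (Icc a b) := by
  refine Measure.integrableOn_of_bounded (M := ∑ k ∈ Finset.range (s.card - 1 + 1),
    ‖f ((s.sort (· ≤ ·)).getD k 0)‖) (by simp)
    (measurable_comp_orderedFunction s f).aestronglyMeasurable (Eventually.of_forall fun x => ?_)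
  exact Finset.single_le_sum (f := fun k => ‖f ((s.sort (· ≤ ·)).getD k 0)‖)
    (fun _ _ => norm_nonneg _) (Finset.mem_range.2 (by omega))

theorem intervalIntegrable_comp_orderedFunction (s : Multiset ℝ) (f : ℝ → ℝ) (a b : ℝ) :
    IntervalIntegrable (fun x => f (orderedFunction s x)) volume a b := by
  rw [intervalIntegrable_iff']
  exact integrableOn_comp_orderedFunction s f _ _

theorem integral_comp_orderedFunction {s : Multiset ℝ} (hs : s ≠ 0) (f : ℝ → ℝ) :
    ∫ x in (0 : ℝ)..1, f (orderedFunction s x) = (s.map f).sum / s.card := by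
  have hn : 0 < s.card := Multiset.card_pos.2 hs
  have hn' : (0 : ℝ) < s.card := by exact_mod_cast hn
  have h := intervalIntegral.sum_integral_adjacent_intervals
    (a := fun k : ℕ => (k : ℝ) / s.card) (n := s.card) (μ := volume)
    (f := fun x => f (orderedFunction s x))
    (fun k _ => intervalIntegrable_comp_orderedFunction s f _ _)
  simp only [Nat.cast_zero, zero_div, div_self hn'.ne'] at h
  rw [← h]
  have hk : ∀ k ∈ Finset.range s.card,
      (∫ x in ((k : ℕ) : ℝ) / s.card..((k + 1 : ℕ) : ℝ) / s.card, f (orderedFunction s x)) =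
        f ((s.sort (· ≤ ·)).getD k 0) / s.card := by
    intro k hk
    have hk' := Finset.mem_range.1 hk
    have : ∀ᵐ x : ℝ, x ∈ uIoc (((k : ℕ) : ℝ) / s.card) (((k + 1 : ℕ) : ℝ) / s.card) →
        f (orderedFunction s x) = f ((s.sort (· ≤ ·)).getD k 0) := by
      have hne : ∀ᵐ x : ℝ, x ≠ ((k + 1 : ℕ) : ℝ) / s.card := by
        simp [ae_iff]
      filter_upwards [hne] with x hx hmem
      rw [uIoc_of_le (by gcongr; omega)] at hmem
      have h1 := hmem.1
      have h2 := lt_of_le_of_ne hmem.2 hx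
      rw [div_lt_iff₀ hn'] at h1
      rw [lt_div_iff₀ hn'] at h2
      have hfl : ⌊(s.card : ℝ) * x⌋₊ = k := by
        rw [Nat.floor_eq_iff (by nlinarith [Nat.cast_nonneg (α := ℝ) k])]
        push_cast at h2
        constructor <;> linarith [mul_comm x (s.card : ℝ)]
      rw [orderedFunction, hfl, min_eq_left (by omega)]
    rw [intervalIntegral.integral_congr_ae this, intervalIntegral.integral_const, smul_eq_mul]
    push_cast
    field_simp
    ring
  rw [Finset.sum_congr rfl hk, ← Finset.sum_div]
  congr 1
  conv_rhs => rw [← Multiset.sort_eq s (· ≤ ·)]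
  rw [Multiset.map_coe, Multiset.sum_coe, ← Fin.sum_univ_eq_sum_range
    (fun k => f ((s.sort (· ≤ ·)).getD k 0)), ← List.sum_ofFn]
  congr 1
  apply List.ext_getElem
  · simp
  · intro i h1 h2
    simp

theorem integral_orderedFunction {s : Multiset ℝ} (hs : s ≠ 0) :
    ∫ x in (0 : ℝ)..1, orderedFunction s x = s.sum / s.card := by
  simpa using integral_comp_orderedFunction hs id

theorem intervalIntegrable_orderedFunction (s : Multiset ℝ) (a b : ℝ) :
    IntervalIntegrable (orderedFunction s) volume a b :=
  intervalIntegrable_comp_orderedFunction s id a b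

theorem ae_ne_one : ∀ᵐ x : ℝ, x ≠ 1 := by simp [ae_iff]

/-- Under stochastic dominance the `L¹` distance is the difference of the means. -/
theorem integral_abs_sub_of_countP {s t : Multiset ℝ} (hs : s ≠ 0) (ht : t ≠ 0)
    (h : ∀ c : ℝ, t.countP (· ≤ c) * s.card ≤ s.countP (· ≤ c) * t.card) :
    ∫ x in (0 : ℝ)..1, |orderedFunction t x - orderedFunction s x| =
      t.sum / t.card - s.sum / s.card := by
  rw [← integral_orderedFunction hs, ← integral_orderedFunction ht,
    ← intervalIntegral.integral_sub (intervalIntegrable_orderedFunction _ _ _)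
      (intervalIntegrable_orderedFunction _ _ _)]
  apply intervalIntegral.integral_congr_ae
  filter_upwards [ae_ne_one] with x hx hmem
  rw [uIoc_of_le zero_le_one] at hmem
  exact abs_of_nonneg (sub_nonneg.2 (orderedFunction_le_of_countP hs ht h hmem.1.le
    (lt_of_le_of_ne hmem.2 hx)))

/-- The integral of an ordered function is at least each of its supporting linear functionals. -/
theorem le_integral_orderedFunction {s : Multiset ℝ} (hs : s ≠ 0) {x : ℝ} (hx : x ∈ Icc (0 : ℝ) 1)
    (c : ℝ) : c * x - (s.map fun a => max (c - a) 0).sum / s.card ≤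
      ∫ t in (0 : ℝ)..x, orderedFunction s t := by
  rw [← integral_comp_orderedFunction hs (fun a => max (c - a) 0),
    ← intervalIntegral.integral_add_adjacent_intervals (b := x)
      (intervalIntegrable_comp_orderedFunction s (fun a => max (c - a) 0) 0 x)
      (intervalIntegrable_comp_orderedFunction s (fun a => max (c - a) 0) x 1)]
  have h1 : 0 ≤ ∫ t in x..1, max (c - orderedFunction s t) 0 :=
    intervalIntegral.integral_nonneg hx.2 fun _ _ => le_max_right _ _
  have h2 : ∫ t in (0 : ℝ)..x, c ≤ ∫ t in (0 : ℝ)..x,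
      (orderedFunction s t + max (c - orderedFunction s t) 0) := by
    apply intervalIntegral.integral_mono_on hx.1 (by simp)
    · exact (intervalIntegrable_orderedFunction _ _ _).add
        (intervalIntegrable_comp_orderedFunction s (fun a => max (c - a) 0) _ _)
    · intro t _
      linarith [le_max_left (c - orderedFunction s t) 0]
  rw [intervalIntegral.integral_add (intervalIntegrable_orderedFunction _ _ _)
        (intervalIntegrable_comp_orderedFunction s (fun a => max (c - a) 0) _ _),
      intervalIntegral.integral_const] at h2
  simp only [sub_zero, smul_eq_mul] at h2
  linarith [mul_comm c x]

/-- The supporting functional with `c` the value at `x` is attained: by monotonicity `(c - f)⁺` is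
`c - f` before `x` and vanishes after it. -/
theorem integral_orderedFunction_eq {s : Multiset ℝ} (hs : s ≠ 0) {x : ℝ} (hx0 : 0 ≤ x)
    (hx1 : x < 1) :
    ∫ t in (0 : ℝ)..x, orderedFunction s t = orderedFunction s x * x -
      (s.map fun a => max (orderedFunction s x - a) 0).sum / s.card := by
  set c := orderedFunction s x with hc
  rw [← integral_comp_orderedFunction hs (fun a => max (c - a) 0),
    ← intervalIntegral.integral_add_adjacent_intervals (b := x)
      (intervalIntegrable_comp_orderedFunction s (fun a => max (c - a) 0) 0 x)
      (intervalIntegrable_comp_orderedFunction s (fun a => max (c - a) 0) x 1)]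
  have h1 : ∫ t in x..1, max (c - orderedFunction s t) 0 = 0 := by
    rw [intervalIntegral.integral_congr_ae (g := fun _ => (0 : ℝ))]
    · simp
    · filter_upwards [ae_ne_one] with t ht hmem
      rw [uIoc_of_le hx1.le] at hmem
      apply max_eq_right
      exact sub_nonpos.2 (orderedFunction_mono hs ⟨hx0, hx1⟩
        ⟨hx0.trans hmem.1.le, lt_of_le_of_ne hmem.2 ht⟩ hmem.1.le)
  have h2 : ∫ t in (0 : ℝ)..x, max (c - orderedFunction s t) 0 =
      ∫ t in (0 : ℝ)..x, (c - orderedFunction s t) := by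
    apply intervalIntegral.integral_congr
    intro t ht
    rw [uIcc_of_le hx0] at ht
    exact max_eq_left (sub_nonneg.2 (orderedFunction_mono hs
      ⟨ht.1, lt_of_le_of_lt ht.2 hx1⟩ ⟨hx0, hx1⟩ ht.2))
  rw [h1, h2, intervalIntegral.integral_sub (by simp) (intervalIntegrable_orderedFunction _ _ _),
    intervalIntegral.integral_const]
  simp only [sub_zero, smul_eq_mul]
  ring

/-- Majorization: if all sums of convex functions `(c - ·)⁺` over `t` are at most those over `s`,
the integrated ordered function of `t` is above that of `s`. -/
theorem integral_orderedFunction_le {s t : Multiset ℝ} (hs : s ≠ 0) (ht : t ≠ 0)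
    (hcard : s.card = t.card) (hsum : s.sum = t.sum)
    (h : ∀ c : ℝ, (t.map fun a => max (c - a) 0).sum ≤ (s.map fun a => max (c - a) 0).sum)
    {x : ℝ} (hx : x ∈ Icc (0 : ℝ) 1) :
    ∫ y in (0 : ℝ)..x, orderedFunction s y ≤ ∫ y in (0 : ℝ)..x, orderedFunction t y := by
  rcases hx.2.lt_or_eq with hx1 | rfl
  · rw [integral_orderedFunction_eq hs hx.1 hx1]
    refine le_trans ?_ (le_integral_orderedFunction ht hx (orderedFunction s x))
    rw [hcard]
    gcongr
    exact h _
  · rw [integral_orderedFunction hs, integral_orderedFunction ht, hcard, hsum]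

/-! ### Counting full flags with prescribed starting vertices -/

section Flags

variable {α : Type*}

/-- Chains of nonempty subsets of `t` with as many members as `t` has elements. -/
noncomputable def fullFlags (t : Finset α) : Finset (Finset (Finset α)) :=
  open Classical in t.powerset.powerset.filter fun c =>
    (∀ s ∈ c, s.Nonempty) ∧ IsChain (· ⊆ ·) (c : Set (Finset α)) ∧ c.card = t.card

theorem mem_fullFlags {t : Finset α} {c : Finset (Finset α)} :
    c ∈ fullFlags t ↔ (∀ s ∈ c, s ⊆ t) ∧ (∀ s ∈ c, s.Nonempty) ∧
      IsChain (· ⊆ ·) (c : Set (Finset α)) ∧ c.card = t.card := by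
  simp only [fullFlags, Finset.mem_filter, Finset.mem_powerset]
  refine and_congr_left' ⟨fun h s hs => Finset.mem_powerset.1 (h hs),
    fun h s hs => Finset.mem_powerset.2 (h s hs)⟩

theorem subset_of_chain_of_card_le {c : Finset (Finset α)}
    (hc : IsChain (· ⊆ ·) (c : Set (Finset α))) {s s' : Finset α} (hs : s ∈ c) (hs' : s' ∈ c)
    (h : s.card ≤ s'.card) : s ⊆ s' := by
  rcases hc.total (Finset.mem_coe.2 hs) (Finset.mem_coe.2 hs') with h1 | h1
  · exact h1
  · exact (Finset.eq_of_subset_of_card_le h1 h).symm.subset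

theorem card_injOn_chain {c : Finset (Finset α)} (hc : IsChain (· ⊆ ·) (c : Set (Finset α))) :
    Set.InjOn Finset.card (c : Set (Finset α)) := fun _ hs _ hs' h =>
  (subset_of_chain_of_card_le hc hs hs' h.le).antisymm
    (subset_of_chain_of_card_le hc hs' hs h.ge)

theorem card_chain_le {t : Finset α} {c : Finset (Finset α)} (ht : ∀ s ∈ c, s ⊆ t)
    (hne : ∀ s ∈ c, s.Nonempty) (hc : IsChain (· ⊆ ·) (c : Set (Finset α))) :
    c.card ≤ t.card := by
  have := Finset.card_le_card_of_injOn (t := Finset.Icc 1 t.card) Finset.card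
    (fun s hs => Finset.mem_coe.2 (Finset.mem_Icc.2
      ⟨(hne s hs).card_pos, Finset.card_le_card (ht s hs)⟩)) (card_injOn_chain hc)
  simpa using this

/-- A chain of `n` nonempty sets of size at most `n` has a member of size `n`. -/
theorem exists_mem_card_eq {c : Finset (Finset α)} {n : ℕ} (hn : 0 < n) (hcn : c.card = n)
    (hle : ∀ s ∈ c, s.card ≤ n) (hne : ∀ s ∈ c, s.Nonempty)
    (hc : IsChain (· ⊆ ·) (c : Set (Finset α))) : ∃ s ∈ c, s.card = n := by
  have himg : c.image Finset.card = Finset.Icc 1 n := by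
    apply Finset.eq_of_subset_of_card_le
    · intro k hk
      obtain ⟨s, hs, rfl⟩ := Finset.mem_image.1 hk
      exact Finset.mem_Icc.2 ⟨(hne s hs).card_pos, hle s hs⟩
    · rw [Finset.card_image_of_injOn (card_injOn_chain hc), hcn]
      simp
  have : n ∈ c.image Finset.card := himg ▸ Finset.mem_Icc.2 ⟨hn, le_rfl⟩
  simpa using this

theorem mem_of_mem_fullFlags {t : Finset α} (ht : t.Nonempty) {c : Finset (Finset α)}
    (hc : c ∈ fullFlags t) : t ∈ c := by
  obtain ⟨h1, h2, h3, h4⟩ := mem_fullFlags.1 hc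
  obtain ⟨s, hs, hst⟩ := exists_mem_card_eq ht.card_pos h4
    (fun s hs => Finset.card_le_card (h1 s hs)) h2 h3
  exact Finset.eq_of_subset_of_card_le (h1 s hs) hst.ge ▸ hs

variable [DecidableEq α]

/-- The full flags of `t` whose smallest member is the singleton of an element of `B`. -/
noncomputable def flagsAt (t B : Finset α) : Finset (Finset (Finset α)) :=
  (fullFlags t).filter fun c => ∃ b ∈ B, {b} ∈ c

theorem notMem_of_mem_fullFlags_erase {t : Finset α} {x : α} (hx : x ∈ t) {c : Finset (Finset α)}
    (hc : c ∈ fullFlags (t.erase x)) : t ∉ c := fun h =>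
  Finset.notMem_erase x t ((mem_fullFlags.1 hc).1 t h hx)

/-- Removing the largest member `t` from a full flag leaves a full flag of `t` minus one point. With
`2 ≤ t.card` the set `t` is not itself the starting singleton. -/
theorem flagsAt_eq_biUnion {t B : Finset α} (ht : 2 ≤ t.card) :
    flagsAt t B = t.biUnion fun x => (flagsAt (t.erase x) B).image (insert t) := by
  have htne : t.Nonempty := Finset.card_pos.1 (by omega)
  ext c
  simp only [flagsAt, Finset.mem_biUnion, Finset.mem_image, Finset.mem_filter]
  constructor
  · rintro ⟨hc, b, hb, hbc⟩
    have htc := mem_of_mem_fullFlags htne hc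
    obtain ⟨h1, h2, h3, h4⟩ := mem_fullFlags.1 hc
    have hcard : (c.erase t).card = t.card - 1 := by
      rw [Finset.card_erase_of_mem htc, h4]
    have h3' : IsChain (· ⊆ ·) ((c.erase t : Finset _) : Set (Finset α)) :=
      h3.mono (Finset.coe_subset.2 (Finset.erase_subset _ _))
    have hlt : ∀ s ∈ c.erase t, s.card ≤ t.card - 1 := by
      intro s hs
      have := Finset.card_lt_card (lt_of_le_of_ne (h1 s (Finset.mem_of_mem_erase hs))
        (Finset.ne_of_mem_erase hs))
      omega
    obtain ⟨s, hs, hscard⟩ := exists_mem_card_eq (by omega) hcard hlt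
      (fun s hs => h2 s (Finset.mem_of_mem_erase hs)) h3'
    have hst := h1 s (Finset.mem_of_mem_erase hs)
    obtain ⟨x, hx⟩ : ∃ x, t \ s = {x} := by
      rw [← Finset.card_eq_one, Finset.card_sdiff_of_subset hst]; omega
    have hxt : x ∈ t := (Finset.mem_sdiff.1 (hx ▸ Finset.mem_singleton_self x)).1
    have hse : s = t.erase x := by
      rw [← Finset.sdiff_singleton_eq_erase, ← hx, Finset.sdiff_sdiff_eq_self hst]
    refine ⟨x, hxt, c.erase t, ⟨mem_fullFlags.2 ⟨fun r hr => ?_, fun r hr =>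
      h2 r (Finset.mem_of_mem_erase hr), h3', ?_⟩, b, hb, ?_⟩, Finset.insert_erase htc⟩
    · rw [← hse]
      exact subset_of_chain_of_card_le h3' hr hs (hscard ▸ hlt r hr)
    · rw [hcard, Finset.card_erase_of_mem hxt]
    · refine Finset.mem_erase.2 ⟨fun h => ?_, hbc⟩
      rw [← h] at ht
      simp at ht
  · rintro ⟨x, hx, c, ⟨hc, b, hb, hbc⟩, rfl⟩
    obtain ⟨h1, h2, h3, h4⟩ := mem_fullFlags.1 hc
    have h1' : ∀ s ∈ c, s ⊆ t := fun s hs => (h1 s hs).trans (Finset.erase_subset _ _)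
    refine ⟨mem_fullFlags.2 ⟨fun s hs => ?_, fun s hs => ?_, ?_, ?_⟩, b, hb,
      Finset.mem_insert_of_mem hbc⟩
    · rcases Finset.mem_insert.1 hs with rfl | hs
      exacts [subset_rfl, h1' s hs]
    · rcases Finset.mem_insert.1 hs with rfl | hs
      exacts [htne, h2 s hs]
    · rw [Finset.coe_insert]
      exact h3.insert fun s hs _ => Or.inr (h1' s hs)
    · rw [Finset.card_insert_of_notMem (notMem_of_mem_fullFlags_erase hx hc), h4,
        Finset.card_erase_of_mem hx]
      omega

theorem sum_card_erase_inter (t B : Finset α) :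
    ∑ x ∈ t, (t.erase x ∩ B).card = (t ∩ B).card * (t.card - 1) := by
  have h : ∀ x ∈ t, (t.erase x ∩ B).card + (if x ∈ B then 1 else 0) = (t ∩ B).card := by
    intro x hx
    rw [Finset.erase_inter]
    split_ifs with hxB
    · exact Finset.card_erase_add_one (Finset.mem_inter.2 ⟨hx, hxB⟩)
    · rw [Finset.erase_eq_of_notMem (fun h => hxB (Finset.mem_inter.1 h).2), add_zero]
  have h2 := Finset.sum_congr rfl h
  rw [Finset.sum_add_distrib, Finset.sum_const, Finset.sum_boole, smul_eq_mul,
    Finset.filter_mem_eq_inter] at h2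
  simp only [Nat.cast_id] at h2
  rw [Nat.mul_sub, mul_one, mul_comm]
  omega

/-- A full flag is an ordering of `t`: the first element is taken from `t ∩ B`, the other `n` are
ordered freely. The induction removes the last element. -/
theorem card_flagsAt_aux (B : Finset α) (n : ℕ) :
    ∀ t : Finset α, t.card = n + 1 → (flagsAt t B).card = (t ∩ B).card * n.factorial := by
  induction n with
  | zero =>
    intro t ht
    obtain ⟨x, rfl⟩ := Finset.card_eq_one.1 ht
    have hff : fullFlags ({x} : Finset α) = {{{x}}} := by
      ext c
      rw [Finset.mem_singleton]
      constructor
      · intro hc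
        have h := mem_of_mem_fullFlags (Finset.singleton_nonempty x) hc
        exact (Finset.eq_of_subset_of_card_le (Finset.singleton_subset_iff.2 h)
          (by rw [(mem_fullFlags.1 hc).2.2.2]; simp)).symm
      · rintro rfl
        exact mem_fullFlags.2 ⟨by simp, by simp, by simp, by simp⟩
    rw [flagsAt, hff]
    by_cases hx : x ∈ B
    · rw [Finset.filter_true_of_mem (by simpa using hx), Finset.singleton_inter_of_mem hx]
      simp
    · rw [Finset.filter_false_of_mem, Finset.singleton_inter_of_notMem hx]
      · simp
      · intro c hc
        rw [Finset.mem_singleton.1 hc]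
        simpa using hx
  | succ n ih =>
    intro t ht
    rw [flagsAt_eq_biUnion (by omega), Finset.card_biUnion]
    · have h : ∀ x ∈ t, ((flagsAt (t.erase x) B).image (insert t)).card =
          (t.erase x ∩ B).card * n.factorial := by
        intro x hx
        rw [Finset.card_image_of_injOn, ih _ (by rw [Finset.card_erase_of_mem hx]; omega)]
        intro c hc c' hc' hcc
        have h1 := notMem_of_mem_fullFlags_erase hx (Finset.mem_filter.1 hc).1
        have h2 := notMem_of_mem_fullFlags_erase hx (Finset.mem_filter.1 hc').1
        rw [← Finset.erase_insert h1, ← Finset.erase_insert h2]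
        exact congrArg (·.erase t) hcc
      rw [Finset.sum_congr rfl h, ← Finset.sum_mul, sum_card_erase_inter, ht, Nat.factorial_succ]
      simp [mul_assoc]
    · intro x hx y hy hxy
      simp only [Function.onFun]
      rw [Finset.disjoint_left]
      rintro _ hc hc'
      obtain ⟨c, hcm, rfl⟩ := Finset.mem_image.1 hc
      obtain ⟨c', hcm', hcc⟩ := Finset.mem_image.1 hc'
      replace hc := (Finset.mem_filter.1 hcm).1
      replace hc' := (Finset.mem_filter.1 hcm').1
      have h1 := notMem_of_mem_fullFlags_erase hx hc
      have h2 := notMem_of_mem_fullFlags_erase hy hc'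
      have heq : c' = c := by
        rw [← Finset.erase_insert h1, ← Finset.erase_insert h2]
        exact congrArg (·.erase t) hcc
      subst heq
      have hne : (t.erase x).Nonempty := Finset.card_pos.1 (by
        rw [Finset.card_erase_of_mem hx]; omega)
      have h3 := (mem_fullFlags.1 hc').1 _ (mem_of_mem_fullFlags hne hc)
      exact Finset.notMem_erase y t (h3 (Finset.mem_erase.2 ⟨hxy.symm, hy⟩))

theorem card_flagsAt {t : Finset α} (ht : t.Nonempty) (B : Finset α) :
    (flagsAt t B).card = (t ∩ B).card * (t.card - 1).factorial :=
  card_flagsAt_aux B _ t (by have := ht.card_pos; omega)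

end Flags

/-! ### One refinement step: simplices as chains, growth of facets and of bad simplices -/

section Combinatorics

open Classical

/-- The vertex set of a simplex. -/
def Simplex.verts {G : FinGraph.{u}} (s : G.Simplex) : Finset G.V := s.1

theorem Simplex.nonempty {G : FinGraph.{u}} (s : G.Simplex) : s.verts.Nonempty := s.2.1

theorem Simplex.isClique {G : FinGraph.{u}} (s : G.Simplex) :
    G.graph.IsClique (s.verts : Set G.V) := s.2.2

theorem Simplex.verts_injective {G : FinGraph.{u}} :
    Function.Injective (Simplex.verts (G := G)) := Subtype.val_injective

/-- The simplex with a given vertex set. -/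
def Simplex.mk {G : FinGraph.{u}} (s : Finset G.V) (hs : s.Nonempty)
    (hc : G.graph.IsClique (s : Set G.V)) : G.Simplex := ⟨s, hs, hc⟩

@[simp] theorem Simplex.verts_mk {G : FinGraph.{u}} (s : Finset G.V) (hs : s.Nonempty)
    (hc : G.graph.IsClique (s : Set G.V)) : (Simplex.mk s hs hc).verts = s := rfl

theorem barycentric_adj {G : FinGraph.{u}} (s t : G.Simplex) :
    G.barycentric.graph.Adj s t ↔ s ≠ t ∧ (s.verts ⊆ t.verts ∨ t.verts ⊆ s.verts) := Iff.rfl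

/-- The family of vertex sets of a set of simplices. -/
noncomputable def chainOf {G : FinGraph.{u}} (q : Finset G.Simplex) : Finset (Finset G.V) :=
  q.map ⟨Simplex.verts, Simplex.verts_injective⟩

section chainOf

variable {G : FinGraph.{u}}

theorem mem_chainOf {q : Finset G.Simplex} {s : Finset G.V} :
    s ∈ chainOf q ↔ ∃ t ∈ q, t.verts = s := by
  simp [chainOf]

theorem verts_mem_chainOf {q : Finset G.Simplex} {s : G.Simplex} :
    s.verts ∈ chainOf q ↔ s ∈ q := by
  rw [mem_chainOf]
  exact ⟨fun ⟨t, ht, h⟩ => Simplex.verts_injective h ▸ ht, fun h => ⟨s, h, rfl⟩⟩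

theorem card_chainOf (q : Finset G.Simplex) : (chainOf q).card = q.card := Finset.card_map _

theorem chainOf_injective : Function.Injective (chainOf (G := G)) := Finset.map_injective _

theorem nonempty_of_mem_chainOf {q : Finset G.Simplex} : ∀ s ∈ chainOf q, s.Nonempty := by
  intro s hs
  obtain ⟨t, _, rfl⟩ := mem_chainOf.1 hs
  exact t.nonempty

/-- The members of a simplex of the barycentric refinement. -/
noncomputable def members (q : G.barycentric.Simplex) : Finset G.Simplex := q.verts

theorem members_injective : Function.Injective (members (G := G)) :=
  Simplex.verts_injective (G := G.barycentric)

theorem members_nonempty (q : G.barycentric.Simplex) : (members q).Nonempty :=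
  q.nonempty

theorem isChain_chainOf {q : Finset G.Simplex}
    (h : G.barycentric.graph.IsClique {s | s ∈ q}) :
    IsChain (· ⊆ ·) (chainOf q : Set (Finset G.V)) := by
  intro s hs t ht hst
  obtain ⟨s, hsq, rfl⟩ := mem_chainOf.1 (Finset.mem_coe.1 hs)
  obtain ⟨t, htq, rfl⟩ := mem_chainOf.1 (Finset.mem_coe.1 ht)
  exact ((barycentric_adj s t).1 (h hsq htq (fun h => hst (congrArg Simplex.verts h)))).2

theorem isChain_members (q : G.barycentric.Simplex) :
    IsChain (· ⊆ ·) (chainOf (members q) : Set (Finset G.V)) :=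
  isChain_chainOf q.isClique

/-- The simplex of the barycentric refinement with given members. -/
noncomputable def ofMembers (q : Finset G.Simplex) (hq : q.Nonempty)
    (hc : IsChain (· ⊆ ·) (chainOf q : Set (Finset G.V))) : G.barycentric.Simplex :=
  Simplex.mk (G := G.barycentric) q hq fun s hs t ht hst =>
    (barycentric_adj (G := G) s t).2 ⟨hst, hc.total (Finset.mem_coe.2 (verts_mem_chainOf.2 hs))
      (Finset.mem_coe.2 (verts_mem_chainOf.2 ht))⟩

theorem members_ofMembers (q : Finset G.Simplex) (hq : q.Nonempty)
    (hc : IsChain (· ⊆ ·) (chainOf q : Set (Finset G.V))) : members (ofMembers q hq hc) = q := rfl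

theorem exists_top (q : G.barycentric.Simplex) :
    ∃ t ∈ members q, ∀ s ∈ members q, s.verts ⊆ t.verts := by
  obtain ⟨t, ht, hmax⟩ := Finset.exists_max_image (members q) (fun s => s.verts.card)
    (members_nonempty q)
  exact ⟨t, ht, fun s hs => subset_of_chain_of_card_le (isChain_members q)
    (verts_mem_chainOf.2 hs) (verts_mem_chainOf.2 ht) (hmax s hs)⟩

/-- The largest member of a simplex of the barycentric refinement. -/
noncomputable def top (q : G.barycentric.Simplex) : G.Simplex := (exists_top q).choose

theorem top_mem (q : G.barycentric.Simplex) : G.top q ∈ members q :=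
  (exists_top q).choose_spec.1

theorem subset_top (q : G.barycentric.Simplex) {s : G.Simplex} (hs : s ∈ members q) :
    s.verts ⊆ (G.top q).verts :=
  (exists_top q).choose_spec.2 s hs

theorem subset_top_of_mem_chainOf (q : G.barycentric.Simplex) :
    ∀ s ∈ chainOf (members q), s ⊆ (G.top q).verts := by
  intro s hs
  obtain ⟨t, ht, rfl⟩ := mem_chainOf.1 hs
  exact subset_top q ht

theorem card_le_card_top (q : G.barycentric.Simplex) :
    (members q).card ≤ (G.top q).verts.card := by
  rw [← card_chainOf (members q)]
  exact card_chain_le (subset_top_of_mem_chainOf q) nonempty_of_mem_chainOf (isChain_members q)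

theorem chainOf_mem_fullFlags (q : G.barycentric.Simplex)
    (h : (members q).card = (G.top q).verts.card) :
    chainOf (members q) ∈ fullFlags (G.top q).verts :=
  mem_fullFlags.2 ⟨subset_top_of_mem_chainOf q, nonempty_of_mem_chainOf,
    isChain_members q, (card_chainOf (members q)).trans h⟩

end chainOf

/-- The simplex contains a vertex with property `bad`. -/
def Simplex.Touches {G : FinGraph.{u}} (t : G.Simplex) (bad : G.V → Prop) : Prop :=
  ∃ v ∈ t.verts, bad v

theorem touches_barycentric {G : FinGraph.{u}} {q : G.barycentric.Simplex}
    {bad' : G.barycentric.V → Prop} : q.Touches bad' ↔ ∃ s ∈ members q, bad' s := Iff.rfl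

/-- The number of complete subgraphs containing a vertex with property `bad`, a complete subgraph
with `j` vertices counted with weight `K ^ j`. -/
noncomputable def touchWeight (K : ℕ) (G : FinGraph.{u}) (bad : G.V → Prop) : ℕ :=
  ∑ t : G.Simplex, if t.Touches bad then K ^ t.verts.card else 0

/-- The chains with top `t` and a bad member are of two kinds. Those of full length start at a bad
vertex, and at most `d * d! ≤ (d+1)! - 1` flags do. There are at most `M = 2 ^ 2 ^ (d+1)` shorter
ones, each of weight at most `(2M) ^ (|t| - 1)`; the base `2M` is chosen so that together they cost
at most half of `(2M) ^ |t|`. The factor `2` on the left clears this half. -/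
theorem sum_fiber_le {G : FinGraph.{u}} {d : ℕ} (hd : ∀ t : G.Simplex, t.verts.card ≤ d + 1)
    {bad : G.V → Prop} {bad' : G.Simplex → Prop}
    (hbad : ∀ s, bad' s → ∀ v ∈ s.verts, bad v)
    (hfull : ∀ t : G.Simplex, t.verts.card = d + 1 → ∃ v ∈ t.verts, ¬ bad v) (t : G.Simplex)
    {S : Finset G.barycentric.Simplex} (hS : ∀ q ∈ S, G.top q = t ∧ ∃ s ∈ members q, bad' s) :
    2 * ∑ q ∈ S, (2 * 2 ^ 2 ^ (d + 1)) ^ (members q).card ≤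
      (2 * (d + 1).factorial - 1) * (2 * 2 ^ 2 ^ (d + 1)) ^ t.verts.card := by
  set M := 2 ^ 2 ^ (d + 1) with hM
  have hM1 : 1 ≤ M := Nat.one_le_two_pow
  have htpos : 0 < t.verts.card := t.nonempty.card_pos
  set B := t.verts.filter bad with hB
  -- A facet has a vertex that is not bad; any other simplex has at most `d` vertices altogether.
  have hBd : (t.verts ∩ B).card ≤ d := by
    have h1 : t.verts ∩ B ⊆ t.verts := Finset.inter_subset_left
    by_cases h : t.verts.card = d + 1
    · obtain ⟨v, hv, hvb⟩ := hfull t h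
      have : t.verts ∩ B ⊂ t.verts := by
        refine Finset.ssubset_iff_subset_ne.2 ⟨h1, fun heq => hvb ?_⟩
        rw [← heq] at hv
        exact (Finset.mem_filter.1 (Finset.mem_inter.1 hv).2).2
      have := Finset.card_lt_card this
      omega
    · have := Finset.card_le_card h1
      have := hd t
      omega
  have hflags : (flagsAt t.verts B).card ≤ (d + 1).factorial - 1 := by
    rw [card_flagsAt t.nonempty]
    have h1 : (t.verts.card - 1).factorial ≤ d.factorial :=
      Nat.factorial_le (by have := hd t; omega)
    have h2 : (t.verts ∩ B).card * (t.verts.card - 1).factorial ≤ d * d.factorial :=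
      Nat.mul_le_mul hBd h1
    have h3 : (d + 1).factorial = d * d.factorial + d.factorial := by
      rw [Nat.factorial_succ]; ring
    have := Nat.factorial_pos d
    omega
  have hfullcard : (S.filter fun q => (members q).card = t.verts.card).card ≤
      (d + 1).factorial - 1 := by
    refine le_trans (Finset.card_le_card_of_injOn (fun q => chainOf (members q)) ?_ ?_) hflags
    · intro q hq
      obtain ⟨hq, hcard⟩ := Finset.mem_filter.1 hq
      obtain ⟨htop, s, hs, hs'⟩ := hS q hq
      have hmem : chainOf (members q) ∈ fullFlags t.verts := by
        have := chainOf_mem_fullFlags q (by rw [htop, hcard])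
        rwa [htop] at this
      refine Finset.mem_coe.2 (Finset.mem_filter.2 ⟨hmem, ?_⟩)
      obtain ⟨h1, h2, h3, h4⟩ := mem_fullFlags.1 hmem
      obtain ⟨r, hr, hmin⟩ := Finset.exists_min_image (chainOf (members q)) Finset.card
        (Finset.card_pos.1 (by omega))
      -- Otherwise the `|t|` distinct sizes of the members would all lie in `[2, |t|]`.
      have hr1 : r.card = 1 := by
        by_contra hne
        have hr0 := (h2 r hr).card_pos
        have := Finset.card_le_card_of_injOn (t := Finset.Icc 2 t.verts.card) Finset.card
          (fun s hs => Finset.mem_coe.2 (Finset.mem_Icc.2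
            ⟨by have := hmin s hs; omega, Finset.card_le_card (h1 s hs)⟩))
          (card_injOn_chain h3)
        rw [Nat.card_Icc] at this
        omega
      obtain ⟨b, rfl⟩ := Finset.card_eq_one.1 hr1
      have hbs : b ∈ s.verts := Finset.singleton_subset_iff.1
        (subset_of_chain_of_card_le h3 hr (verts_mem_chainOf.2 hs) (hmin _ (verts_mem_chainOf.2 hs)))
      exact ⟨b, Finset.mem_filter.2 ⟨Finset.singleton_subset_iff.1 (h1 _ hr),
        hbad s hs' b hbs⟩, hr⟩
    · intro q _ q' _ h
      exact members_injective (chainOf_injective h)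
  have hScard : (S.filter fun q => ¬ (members q).card = t.verts.card).card ≤ M := by
    refine le_trans (Finset.card_le_card_of_injOn (t := t.verts.powerset.powerset)
      (fun q => chainOf (members q)) ?_ ?_) ?_
    · intro q hq
      have htop := (hS q (Finset.mem_filter.1 hq).1).1
      refine Finset.mem_coe.2 (Finset.mem_powerset.2 fun s hs => Finset.mem_powerset.2 ?_)
      rw [← htop]
      exact subset_top_of_mem_chainOf q s hs
    · intro q _ q' _ h
      exact members_injective (chainOf_injective h)
    · rw [Finset.card_powerset, Finset.card_powerset]
      exact Nat.pow_le_pow_right two_pos (Nat.pow_le_pow_right two_pos (hd t))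
  rw [← Finset.sum_filter_add_sum_filter_not S (fun q => (members q).card = t.verts.card)]
  have e1 : ∑ q ∈ S.filter (fun q => (members q).card = t.verts.card),
      (2 * M) ^ (members q).card ≤
      ((d + 1).factorial - 1) * (2 * M) ^ t.verts.card := by
    refine le_trans (Finset.sum_le_card_nsmul _ _ ((2 * M) ^ t.verts.card) fun q hq => ?_) ?_
    · rw [(Finset.mem_filter.1 hq).2]
    · rw [smul_eq_mul]
      exact Nat.mul_le_mul_right _ hfullcard
  have e2 : ∑ q ∈ S.filter (fun q => ¬ (members q).card = t.verts.card),
      (2 * M) ^ (members q).card ≤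
      M * (2 * M) ^ (t.verts.card - 1) := by
    refine le_trans (Finset.sum_le_card_nsmul _ _ ((2 * M) ^ (t.verts.card - 1)) fun q hq => ?_) ?_
    · obtain ⟨hq, hne⟩ := Finset.mem_filter.1 hq
      have hle := card_le_card_top q
      rw [(hS q hq).1] at hle
      exact Nat.pow_le_pow_right (by omega) (by omega)
    · rw [smul_eq_mul]
      exact Nat.mul_le_mul_right _ hScard
  have e3 : 2 * (M * (2 * M) ^ (t.verts.card - 1)) = (2 * M) ^ t.verts.card := by
    rw [← mul_assoc, ← pow_succ', Nat.sub_add_cancel htpos]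
  have e4 : 2 * (d + 1).factorial - 1 = 2 * ((d + 1).factorial - 1) + 1 := by
    have := Nat.factorial_pos (d + 1)
    omega
  rw [e4, add_mul, one_mul, mul_assoc]
  omega

/-- Group the chains by their largest member. A chain with a bad member has a top that contains all
vertices of that member, hence a bad vertex, so only fibers over touching simplices contribute. -/
theorem touchWeight_barycentric_le {G : FinGraph.{u}} {d : ℕ}
    (hd : ∀ t : G.Simplex, t.verts.card ≤ d + 1)
    {bad : G.V → Prop} {bad' : G.barycentric.V → Prop}
    (hbad : ∀ s : G.Simplex, bad' s → ∀ v ∈ s.verts, bad v)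
    (hfull : ∀ t : G.Simplex, t.verts.card = d + 1 → ∃ v ∈ t.verts, ¬ bad v) :
    2 * touchWeight (2 * 2 ^ 2 ^ (d + 1)) G.barycentric bad' ≤
      (2 * (d + 1).factorial - 1) * touchWeight (2 * 2 ^ 2 ^ (d + 1)) G bad := by
  rw [touchWeight, touchWeight, ← Finset.sum_filter,
    ← Finset.sum_fiberwise _ (fun q => G.top q), Finset.mul_sum, Finset.mul_sum]
  refine Finset.sum_le_sum fun t _ => ?_
  split_ifs with h
  · refine sum_fiber_le hd hbad hfull t fun q hq => ?_
    obtain ⟨hq, htop⟩ := Finset.mem_filter.1 hq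
    exact ⟨htop, touches_barycentric.1 (Finset.mem_filter.1 hq).2⟩
  · rw [Finset.filter_false_of_mem]
    · simp
    · rintro q hq rfl
      obtain ⟨s, hs, hbs⟩ := touches_barycentric.1 (Finset.mem_filter.1 hq).2
      obtain ⟨v, hv⟩ := s.nonempty
      exact h ⟨v, subset_top q hs hv, hbad s hbs v hv⟩

/-- The number of complete subgraphs with `n` vertices. -/
noncomputable def numSimplices (G : FinGraph.{u}) (n : ℕ) : ℕ :=
  (Finset.univ.filter fun t : G.Simplex => t.verts.card = n).card

/-- Each simplex with `d + 1` vertices has `(d+1)!` full flags, which are simplices of the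
refinement; a full flag determines its simplex as its largest member. -/
theorem factorial_mul_numSimplices_le (G : FinGraph.{u}) (d : ℕ) :
    (d + 1).factorial * G.numSimplices (d + 1) ≤ G.barycentric.numSimplices (d + 1) := by
  have hsum : (d + 1).factorial * G.numSimplices (d + 1) =
      ((Finset.univ.filter fun t : G.Simplex => t.verts.card = d + 1).biUnion
        fun t => flagsAt t.verts t.verts).card := by
    rw [Finset.card_biUnion]
    · rw [Finset.sum_congr rfl (g := fun _ => (d + 1).factorial), Finset.sum_const, smul_eq_mul,
        mul_comm, numSimplices]
      intro t ht
      rw [card_flagsAt t.nonempty, Finset.inter_self, (Finset.mem_filter.1 ht).2, Nat.factorial_succ]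
      simp
    · intro t _ t' _ hne
      simp only [Function.onFun]
      rw [Finset.disjoint_left]
      intro c hc hc'
      have h1 := (Finset.mem_filter.1 hc).1
      have h2 := (Finset.mem_filter.1 hc').1
      exact hne (Simplex.verts_injective
        (((mem_fullFlags.1 h2).1 _ (mem_of_mem_fullFlags t.nonempty h1)).antisymm
        ((mem_fullFlags.1 h1).1 _ (mem_of_mem_fullFlags t'.nonempty h2))))
  rw [hsum, numSimplices]
  refine le_trans (Finset.card_le_card (t := (Finset.univ.filter
    fun q : G.barycentric.Simplex => (members q).card = d + 1).image
      fun q => chainOf (members q)) ?_)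
    Finset.card_image_le
  intro c hc
  obtain ⟨t, ht, hc⟩ := Finset.mem_biUnion.1 hc
  obtain ⟨h1, h2, h3, h4⟩ := mem_fullFlags.1 (Finset.mem_filter.1 hc).1
  have htc := mem_of_mem_fullFlags t.nonempty (Finset.mem_filter.1 hc).1
  have hq : chainOf (Finset.univ.filter fun s : G.Simplex => s.verts ∈ c) = c := by
    ext s
    rw [mem_chainOf]
    constructor
    · rintro ⟨r, hr, rfl⟩
      exact (Finset.mem_filter.1 hr).2
    · intro hs
      exact ⟨Simplex.mk s (h2 s hs) (t.isClique.subset (Finset.coe_subset.2 (h1 s hs))),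
        by simpa using hs, rfl⟩
  have hchain : IsChain (· ⊆ ·) (chainOf (Finset.univ.filter fun s : G.Simplex => s.verts ∈ c) :
      Set (Finset G.V)) := by rw [hq]; exact h3
  have hne : (Finset.univ.filter fun s : G.Simplex => s.verts ∈ c).Nonempty :=
    ⟨t, by simpa using htc⟩
  refine Finset.mem_image.2 ⟨ofMembers _ hne hchain,
    Finset.mem_filter.2 ⟨Finset.mem_univ _, ?_⟩, hq⟩
  rw [members_ofMembers, ← (Finset.mem_filter.1 ht).2, ← h4, ← card_chainOf, hq]

end Combinatorics

/-! ### Iterated refinements, supports in the original graph, functoriality -/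

section Iteration

open Classical

/-- The iterated barycentric refinement, by recursion on the last step. -/
noncomputable def iter (G : FinGraph.{u}) : ℕ → FinGraph.{u}
  | 0 => G
  | k + 1 => (iter G k).barycentric

theorem refinement_eq_iter (G : FinGraph.{u}) (k : ℕ) : G.refinement k = G.iter k := by
  induction k with
  | zero => rfl
  | succ k ih => rw [refinement, Function.iterate_succ_apply', ← refinement, ih, iter]

theorem iter_barycentric (G : FinGraph.{u}) (k : ℕ) : G.barycentric.iter k = G.iter (k + 1) := by
  rw [← refinement_eq_iter, ← refinement_eq_iter]
  rfl

/-- The vertices of `G` that occur hereditarily in a vertex of an iterated refinement. -/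
noncomputable def supp (G : FinGraph.{u}) : (k : ℕ) → (G.iter k).V → Finset G.V
  | 0, v => {(show G.V from v)}
  | k + 1, s => (Simplex.verts (G := G.iter k) s).biUnion (supp G k)

theorem supp_succ (G : FinGraph.{u}) (k : ℕ) (s : (G.iter k).Simplex) :
    G.supp (k + 1) s = s.verts.biUnion (G.supp k) := rfl

theorem supp_one (G : FinGraph.{u}) (s : G.Simplex) : G.supp 1 s = s.verts := by
  ext x
  refine Finset.mem_biUnion.trans ?_
  constructor
  · rintro ⟨v, hv, hx⟩
    rwa [Finset.mem_singleton.1 hx]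
  · intro hx
    exact ⟨x, hx, Finset.mem_singleton_self x⟩

theorem supp_subset_supp {G : FinGraph.{u}} {k : ℕ} {s t : (G.iter k).Simplex}
    (h : s.verts ⊆ t.verts) : G.supp (k + 1) s ⊆ G.supp (k + 1) t :=
  Finset.biUnion_subset_biUnion_of_subset_left _ h

theorem supp_eq_supp_top {G : FinGraph.{u}} {k : ℕ} (q : (G.iter k).barycentric.Simplex) :
    G.supp (k + 2) q = G.supp (k + 1) (top q) :=
  (Finset.biUnion_subset.2 fun _ hs => supp_subset_supp (subset_top q hs)).antisymm
    (Finset.subset_biUnion_of_mem (G.supp (k + 1)) (top_mem q))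

/-- The support of a chain is that of its largest member, and a chain is no longer than its largest
member is large; both claims thus descend to the first level. This is what keeps the clique number
from growing. -/
theorem supp_succ_isClique (G : FinGraph.{u}) (k : ℕ) : ∀ s : (G.iter k).Simplex,
    G.graph.IsClique (G.supp (k + 1) s : Set G.V) ∧ s.verts.card ≤ (G.supp (k + 1) s).card := by
  induction k with
  | zero =>
    intro s
    have h := supp_one G s
    exact ⟨by rw [h]; exact s.isClique, by rw [h]; rfl⟩
  | succ k ih =>
    intro q
    have h := supp_eq_supp_top (G := G) (k := k) q
    exact ⟨by rw [h]; exact (ih _).1, by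
      rw [h]; exact (card_le_card_top (G := G.iter k) q).trans (ih _).2⟩

theorem supp_subset_of_mem {G : FinGraph.{u}} {k : ℕ} {s : (G.iter k).Simplex} {v : (G.iter k).V}
    (hv : v ∈ s.verts) : G.supp k v ⊆ G.supp (k + 1) s :=
  Finset.subset_biUnion_of_mem (G.supp k) hv

/-- An edge is a simplex with two vertices, whose support one level up is the union of theirs. -/
theorem supp_union_isClique_of_adj {G : FinGraph.{u}} {k : ℕ} {v w : (G.iter k).V}
    (h : (G.iter k).graph.Adj v w) :
    G.graph.IsClique ((G.supp k v ∪ G.supp k w : Finset G.V) : Set G.V) := by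
  have hc : (G.iter k).graph.IsClique (({v, w} : Finset (G.iter k).V) : Set (G.iter k).V) := by
    rw [Finset.coe_pair, SimpleGraph.isClique_pair]
    exact fun _ => h
  have := (supp_succ_isClique G k (Simplex.mk {v, w} (by simp) hc)).1
  rwa [supp_succ, Simplex.verts_mk, Finset.biUnion_insert, Finset.singleton_biUnion] at this

/-- The map induced by an induced embedding on the barycentric refinements. -/
noncomputable def barycentricEmb {A B : FinGraph.{u}} (f : A.graph ↪g B.graph) :
    A.barycentric.graph ↪g B.barycentric.graph where
  toFun := fun s : A.Simplex => Simplex.mk (s.verts.map f.toEmbedding)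
    (s.nonempty.map) (by
      intro x hx y hy hxy
      simp only [Finset.coe_map, Set.mem_image, Finset.mem_coe] at hx hy
      obtain ⟨x, hx, rfl⟩ := hx
      obtain ⟨y, hy, rfl⟩ := hy
      exact f.map_rel_iff.2 (s.isClique hx hy fun h => hxy (congrArg _ h)))
  inj' := fun _ _ h => Simplex.verts_injective
    (Finset.map_injective f.toEmbedding (congrArg Simplex.verts h))
  map_rel_iff' := by
    intro s t
    refine (barycentric_adj (G := B) _ _).trans (Iff.trans ?_ (barycentric_adj (G := A) s t).symm)
    refine and_congr (not_congr ⟨fun h => Simplex.verts_injective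
      (Finset.map_injective f.toEmbedding (congrArg Simplex.verts h)), fun h => by rw [h]⟩)
      (or_congr Finset.map_subset_map Finset.map_subset_map)

/-- The map induced by an induced embedding on the iterated refinements. -/
noncomputable def iterEmb {A B : FinGraph.{u}} (f : A.graph ↪g B.graph) :
    (k : ℕ) → (A.iter k).graph ↪g (B.iter k).graph
  | 0 => f
  | k + 1 => barycentricEmb (iterEmb f k)

theorem supp_iterEmb {A B : FinGraph.{u}} (f : A.graph ↪g B.graph) (k : ℕ) :
    ∀ v, B.supp k (iterEmb f k v) = (A.supp k v).map f.toEmbedding := by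
  induction k with
  | zero => intro v; exact (Finset.map_singleton f.toEmbedding v).symm
  | succ k ih =>
    intro (s : (A.iter k).Simplex)
    have h : B.supp (k + 1) (iterEmb f (k + 1) s) =
      (s.verts.map (iterEmb f k).toEmbedding).biUnion (B.supp k) := rfl
    rw [h, supp_succ]
    ext x
    simp only [Finset.mem_biUnion, Finset.mem_map]
    constructor
    · rintro ⟨_, ⟨v, hv, rfl⟩, hx⟩
      rw [show B.supp k ((iterEmb f k).toEmbedding v) = _ from ih v] at hx
      obtain ⟨y, hy, rfl⟩ := Finset.mem_map.1 hx
      exact ⟨y, ⟨v, hv, hy⟩, rfl⟩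
    · rintro ⟨y, ⟨v, hv, hy⟩, rfl⟩
      refine ⟨_, ⟨v, hv, rfl⟩, ?_⟩
      rw [show B.supp k ((iterEmb f k).toEmbedding v) = _ from ih v]
      exact Finset.mem_map_of_mem _ hy

/-- The support decides membership in the image: a preimage is assembled simplex by simplex, and it
is again a clique because the embeddings are induced. -/
theorem exists_iterEmb_eq {A B : FinGraph.{u}} (f : A.graph ↪g B.graph) (k : ℕ) :
    ∀ w, (∀ x ∈ B.supp k w, ∃ y, f y = x) → ∃ v, iterEmb f k v = w := by
  induction k with
  | zero => intro w hw; exact hw w (Finset.mem_singleton_self _)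
  | succ k ih =>
    intro (s : (B.iter k).Simplex) hs
    have h : ∀ w ∈ s.verts, ∃ v, iterEmb f k v = w := fun w hw =>
      ih w fun x hx => hs x (supp_subset_of_mem hw hx)
    set p := Finset.univ.filter fun v => iterEmb f k v ∈ s.verts with hp
    have hmap : p.map (iterEmb f k).toEmbedding = s.verts := by
      ext w
      simp only [Finset.mem_map, hp, Finset.mem_filter, Finset.mem_univ, true_and]
      constructor
      · rintro ⟨v, hv, rfl⟩
        exact hv
      · intro hw
        obtain ⟨v, rfl⟩ := h w hw
        exact ⟨v, hw, rfl⟩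
    have hne : p.Nonempty := by
      rw [← Finset.map_nonempty (f := (iterEmb f k).toEmbedding), hmap]
      exact s.nonempty
    have hc : (A.iter k).graph.IsClique (p : Set (A.iter k).V) := by
      intro x hx y hy hxy
      rw [← (iterEmb f k).map_rel_iff]
      exact s.isClique (Finset.mem_filter.1 hx).2 (Finset.mem_filter.1 hy).2
        fun h => hxy ((iterEmb f k).injective h)
    exact ⟨Simplex.mk p hne hc, Simplex.verts_injective hmap⟩

theorem pow_factorial_le_numSimplices (G : FinGraph.{u}) (d k : ℕ)
    (h : 0 < G.numSimplices (d + 1)) :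
    (d + 1).factorial ^ k ≤ (G.iter k).numSimplices (d + 1) := by
  induction k with
  | zero => exact h
  | succ k ih =>
    rw [pow_succ']
    exact (Nat.mul_le_mul_left _ ih).trans (factorial_mul_numSimplices_le (G.iter k) d)

theorem numSimplices_pos {G : FinGraph.{u}} {d : ℕ} (h : G.graph.cliqueNum = d + 1) :
    0 < G.numSimplices (d + 1) := by
  obtain ⟨s, hs⟩ := G.graph.exists_isNClique_cliqueNum
  rw [h] at hs
  exact Finset.card_pos.2 ⟨Simplex.mk s (Finset.card_pos.1 (by rw [hs.card_eq]; omega)) hs.isClique,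
    Finset.mem_filter.2 ⟨Finset.mem_univ _, hs.card_eq⟩⟩

section CliqueNumber

variable {G : FinGraph.{u}} {d : ℕ} (hG : ∀ s : Finset G.V, G.graph.IsClique (s : Set G.V) →
  s.card ≤ d + 1)

include hG

theorem card_supp_succ_le (k : ℕ) (s : (G.iter k).Simplex) : (G.supp (k + 1) s).card ≤ d + 1 :=
  hG _ (supp_succ_isClique G k s).1

theorem card_verts_le (k : ℕ) (s : (G.iter k).Simplex) : s.verts.card ≤ d + 1 :=
  (supp_succ_isClique G k s).2.trans (card_supp_succ_le hG k s)

theorem card_supp_eq_of_subset {k : ℕ} {v : (G.iter k).V} {s : (G.iter k).Simplex}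
    (hv : v ∈ s.verts) (h : (G.supp k v).card = d + 1) : (G.supp (k + 1) s).card = d + 1 :=
  le_antisymm (card_supp_succ_le hG k s) (h ▸ Finset.card_le_card (supp_subset_of_mem hv))

/-- Supplies the vertex of full support that every facet of a refinement must have for the boundary
estimate. -/
theorem card_supp_top {k : ℕ} (q : (G.iter k).barycentric.Simplex)
    (h : (members q).card = d + 1) : (G.supp (k + 1) (top q)).card = d + 1 :=
  le_antisymm (card_supp_succ_le hG k _)
    (h ▸ (card_le_card_top q).trans (supp_succ_isClique G k _).2)

/-- The union of the two supports is a clique, hence no larger than either. So the interiors of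
different facets are not joined by edges. -/
theorem supp_eq_of_adj {k : ℕ} {v w : (G.iter k).V} (h : (G.iter k).graph.Adj v w)
    (hv : (G.supp k v).card = d + 1) (hw : (G.supp k w).card = d + 1) :
    G.supp k v = G.supp k w := by
  have h1 := hG _ (supp_union_isClique_of_adj h)
  rw [Finset.eq_of_subset_of_card_le Finset.subset_union_left (h1.trans hv.ge)]
  exact (Finset.eq_of_subset_of_card_le Finset.subset_union_right (h1.trans hw.ge)).symm

/-- The recursion starts at level `1`: at level `0` supports are single vertices, so for `d ≥ 1` no
facet has a vertex of full support. -/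
theorem touchWeight_iter_le (k : ℕ) :
    2 ^ k * touchWeight (2 * 2 ^ 2 ^ (d + 1)) (G.iter (k + 1))
        (fun v => (G.supp (k + 1) v).card ≠ d + 1) ≤
      (2 * (d + 1).factorial - 1) ^ k * touchWeight (2 * 2 ^ 2 ^ (d + 1)) (G.iter 1)
        (fun v => (G.supp 1 v).card ≠ d + 1) := by
  induction k with
  | zero => simp
  | succ k ih =>
    have h := touchWeight_barycentric_le (G := G.iter (k + 1)) (d := d)
      (bad := fun v => (G.supp (k + 1) v).card ≠ d + 1)
      (bad' := fun v => (G.supp (k + 2) v).card ≠ d + 1)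
      (card_verts_le hG (k + 1))
      (fun s hs v hv hvd => hs (card_supp_eq_of_subset hG hv hvd))
      (fun t ht => ⟨top (G := G.iter k) t, top_mem (G := G.iter k) t,
        not_not.2 (card_supp_top hG (k := k) t ht)⟩)
    rw [pow_succ 2 k, pow_succ' (2 * (d + 1).factorial - 1) k, mul_assoc, mul_assoc]
    refine (Nat.mul_le_mul_left _ h).trans ?_
    rw [mul_left_comm]
    exact Nat.mul_le_mul_left _ ih

theorem cliqueNum_iter (k : ℕ) (h : G.graph.cliqueNum = d + 1) :
    (G.iter k).graph.cliqueNum = d + 1 := by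
  apply le_antisymm
  · obtain ⟨s, hs⟩ := (G.iter k).graph.exists_isNClique_cliqueNum
    rcases s.eq_empty_or_nonempty with rfl | hne
    · rw [← hs.card_eq]; simp
    · rw [← hs.card_eq]
      exact card_verts_le hG k (Simplex.mk s hne hs.isClique)
  · have := pow_factorial_le_numSimplices G d k (numSimplices_pos h)
    obtain ⟨t, ht⟩ := Finset.card_pos.1 (lt_of_lt_of_le (pow_pos (Nat.factorial_pos _) _) this)
    rw [← (Finset.mem_filter.1 ht).2]
    exact SimpleGraph.IsClique.card_le_cliqueNum (tc := t.isClique)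

end CliqueNumber

end Iteration

/-! ### Edge-monotone functionals and their stability in L¹ -/

section Functional

open Classical

/-- The number of ordered pairs of adjacent vertices. -/
noncomputable def numAdj {V : Type u} [Fintype V] (A : SimpleGraph V) : ℕ :=
  (Finset.univ.filter fun p : V × V => A.Adj p.1 p.2).card

/-- A multiset of nonnegative numbers attached to a graph, one for every vertex, with sum twice
the number of edges, that increases with the set of edges and is additive on disjoint unions. -/
structure IsEdgeMonotone (Φ : FinGraph.{u} → Multiset ℝ) : Prop where
  card_eq : ∀ G, (Φ G).card = Fintype.card G.V
  nonneg : ∀ G, ∀ a ∈ Φ G, 0 ≤ a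
  sum_eq : ∀ G, (Φ G).sum = numAdj G.graph
  mono : ∀ (V : Type u) [Fintype V] (A B : SimpleGraph V), A ≤ B → ∀ c : ℝ,
    (Φ ⟨V, B⟩).countP (· ≤ c) ≤ (Φ ⟨V, A⟩).countP (· ≤ c)
  blocks : ∀ (R G : FinGraph.{u}) (ι Z : Type u) [Fintype ι] [Fintype Z]
    (e : (ι × R.V) ⊕ Z ≃ G.V),
    (∀ i x j y, G.graph.Adj (e (Sum.inl (i, x))) (e (Sum.inl (j, y))) ↔
      i = j ∧ R.graph.Adj x y) →
    (∀ z w, ¬ G.graph.Adj (e (Sum.inr z)) w) →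
    Φ G = Fintype.card ι • Φ R + Multiset.replicate (Fintype.card Z) 0

/-- The multiset of `A` is dominated by that of `G`, which has more edges, and by that of `R`, since
it consists of copies of the latter and zeros. Both distances are then differences of means: deleted
adjacencies per vertex of `G`, and the mean for `R` times the share of the isolated vertices. -/
theorem integral_abs_sub_le_of_blocks {Φ : FinGraph.{u} → Multiset ℝ} (hΦ : IsEdgeMonotone Φ)
    (R G : FinGraph.{u}) (A : SimpleGraph G.V) (hA : A ≤ G.graph) (ι Z : Type u) [Fintype ι]
    [Fintype Z] [Nonempty ι] [Nonempty R.V] (e : (ι × R.V) ⊕ Z ≃ G.V)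
    (h1 : ∀ i x j y, A.Adj (e (Sum.inl (i, x))) (e (Sum.inl (j, y))) ↔
      i = j ∧ R.graph.Adj x y)
    (h2 : ∀ z w, ¬ A.Adj (e (Sum.inr z)) w) :
    ∫ x in (0 : ℝ)..1, |orderedFunction (Φ G) x - orderedFunction (Φ R) x| ≤
      ((numAdj G.graph : ℝ) - numAdj A) / Fintype.card G.V +
        numAdj A / (Fintype.card ι * Fintype.card R.V) *
          (Fintype.card Z / Fintype.card G.V) := by
  have hb := hΦ.blocks R ⟨G.V, A⟩ ι Z e h1 h2
  have hcG := hΦ.card_eq G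
  have hcA : (Φ ⟨G.V, A⟩).card = Fintype.card G.V := hΦ.card_eq ⟨G.V, A⟩
  have hcR := hΦ.card_eq R
  have hsA : (Φ ⟨G.V, A⟩).sum = numAdj A := hΦ.sum_eq ⟨G.V, A⟩
  have hV : Fintype.card G.V = Fintype.card ι * Fintype.card R.V + Fintype.card Z := by
    rw [← Fintype.card_congr e, Fintype.card_sum, Fintype.card_prod]
  have hι : 0 < Fintype.card ι := Fintype.card_pos
  have hR : 0 < Fintype.card R.V := Fintype.card_pos
  have hVpos : 0 < Fintype.card G.V := by
    rw [hV]; positivity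
  have hG0 : Φ G ≠ 0 := Multiset.card_pos.1 (by omega)
  have hA0 : Φ ⟨G.V, A⟩ ≠ 0 := Multiset.card_pos.1 (by omega)
  have hR0 : Φ R ≠ 0 := Multiset.card_pos.1 (by omega)
  have d1 := integral_abs_sub_of_countP hA0 hG0 fun c => by
    rw [hcG, hcA]
    exact Nat.mul_le_mul_right _ (hΦ.mono G.V A G.graph hA c)
  have d2 := integral_abs_sub_of_countP hA0 hR0 fun c => by
    -- For `c ≥ 0` all the added zeros are counted; for `c < 0` nothing is, by nonnegativity.
    have hz : Fintype.card Z * (Φ R).countP (· ≤ c) ≤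
        (Multiset.replicate (Fintype.card Z) (0 : ℝ)).countP (· ≤ c) * Fintype.card R.V := by
      by_cases hc : 0 ≤ c
      · have h0 : (Multiset.replicate (Fintype.card Z) (0 : ℝ)).countP (· ≤ c) =
            (Multiset.replicate (Fintype.card Z) (0 : ℝ)).card :=
          Multiset.countP_eq_card.2 fun a ha => (Multiset.eq_of_mem_replicate ha).trans_le hc
        rw [h0, Multiset.card_replicate, ← hcR]
        exact Nat.mul_le_mul_left _ (Multiset.countP_le_card _ _)
      · rw [Multiset.countP_eq_zero.2 (fun a ha h => hc ((hΦ.nonneg R a ha).trans h))]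
        simp
    rw [hcA, hcR, hV, hb, Multiset.countP_add, Multiset.countP_nsmul]
    nlinarith
  have hsum : (Fintype.card ι : ℝ) * (Φ R).sum = numAdj A := by
    rw [← hsA, hb, Multiset.sum_add, Multiset.sum_nsmul, nsmul_eq_mul]
    simp
  have hV' : (Fintype.card G.V : ℝ) = Fintype.card ι * Fintype.card R.V + Fintype.card Z := by
    exact_mod_cast hV
  have hι' : (0 : ℝ) < Fintype.card ι := by exact_mod_cast hι
  have hR' : (0 : ℝ) < Fintype.card R.V := by exact_mod_cast hR
  have hVpos' : (0 : ℝ) < Fintype.card G.V := by exact_mod_cast hVpos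
  have hi : ∀ s t : Multiset ℝ, IntervalIntegrable
      (fun x => |orderedFunction s x - orderedFunction t x|) volume 0 1 := fun s t =>
    ((intervalIntegrable_orderedFunction s 0 1).sub
      (intervalIntegrable_orderedFunction t 0 1)).abs
  calc ∫ x in (0 : ℝ)..1, |orderedFunction (Φ G) x - orderedFunction (Φ R) x|
      ≤ ∫ x in (0 : ℝ)..1, (|orderedFunction (Φ G) x - orderedFunction (Φ ⟨G.V, A⟩) x| +
          |orderedFunction (Φ R) x - orderedFunction (Φ ⟨G.V, A⟩) x|) := by
        apply intervalIntegral.integral_mono_on zero_le_one (hi _ _) ((hi _ _).add (hi _ _))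
        intro x _
        rw [abs_sub_comm (orderedFunction (Φ R) x)]
        exact abs_sub_le _ _ _
    _ = _ := by
        rw [intervalIntegral.integral_add (hi _ _) (hi _ _), d1, d2, hcA, hcG, hcR, hΦ.sum_eq G,
          hsA, ← hsum, ← sub_div]
        congr 1
        rw [hV'] at hVpos' ⊢
        field_simp
        ring

end Functional

/-! ### Counting edges of a refinement -/

section Counting

open Classical

theorem card_pairs_le {G : FinGraph.{u}} {d : ℕ} (hd : ∀ t : G.Simplex, t.verts.card ≤ d + 1)
    (P : G.Simplex → Prop) :
    (Finset.univ.filter fun p : G.Simplex × G.Simplex =>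
      p.1.verts ⊆ p.2.verts ∧ P p.2).card ≤ 2 ^ (d + 1) * (Finset.univ.filter P).card := by
  refine Finset.card_le_mul_card_image_of_maps_to (f := Prod.snd)
    (fun p hp => by simpa using (Finset.mem_filter.1 hp).2.2) _ fun t _ => ?_
  refine (Finset.card_le_card_of_injOn (t := t.verts.powerset) (fun p => p.1.verts) ?_ ?_).trans ?_
  · intro p hp
    obtain ⟨hp1, rfl⟩ := Finset.mem_filter.1 hp
    exact Finset.mem_coe.2 (Finset.mem_powerset.2 (Finset.mem_filter.1 hp1).2.1)
  · intro p hp p' hp' h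
    exact Prod.ext (Simplex.verts_injective h)
      ((Finset.mem_filter.1 hp).2.trans (Finset.mem_filter.1 hp').2.symm)
  · rw [Finset.card_powerset]
    exact Nat.pow_le_pow_right two_pos (hd t)

theorem card_pairs_le' {G : FinGraph.{u}} {d : ℕ} (hd : ∀ t : G.Simplex, t.verts.card ≤ d + 1)
    (P : G.Simplex → Prop) :
    (Finset.univ.filter fun p : G.Simplex × G.Simplex =>
      p.2.verts ⊆ p.1.verts ∧ P p.1).card ≤ 2 ^ (d + 1) * (Finset.univ.filter P).card := by
  refine le_trans (Finset.card_le_card_of_injOn Prod.swap ?_ Prod.swap_injective.injOn)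
    (card_pairs_le hd P)
  intro p hp
  simpa using hp

/-- A set of pairs of comparable simplices with `P` for the larger member is small. -/
theorem card_le_of_comparable {G : FinGraph.{u}} {d : ℕ}
    (hd : ∀ t : G.Simplex, t.verts.card ≤ d + 1) (P : G.Simplex → Prop)
    (S : Finset (G.Simplex × G.Simplex))
    (hS : ∀ p ∈ S, (p.1.verts ⊆ p.2.verts ∧ P p.2) ∨ (p.2.verts ⊆ p.1.verts ∧ P p.1)) :
    S.card ≤ 2 ^ (d + 2) * (Finset.univ.filter P).card := by
  have h : S ⊆ (Finset.univ.filter fun p : G.Simplex × G.Simplex =>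
      p.1.verts ⊆ p.2.verts ∧ P p.2) ∪ (Finset.univ.filter fun p : G.Simplex × G.Simplex =>
      p.2.verts ⊆ p.1.verts ∧ P p.1) := by
    intro p hp
    simpa using hS p hp
  refine (Finset.card_le_card h).trans ((Finset.card_union_le _ _).trans ?_)
  have h1 := card_pairs_le hd P
  have h2 := card_pairs_le' hd P
  have h3 : 2 ^ (d + 2) = 2 * 2 ^ (d + 1) := pow_succ' _ _
  rw [h3, mul_assoc]
  omega

/-- The subgraph of the edges between vertices with property `good`. -/
def restrictEdges {V : Type u} (A : SimpleGraph V) (good : V → Prop) : SimpleGraph V where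
  Adj v w := A.Adj v w ∧ good v ∧ good w
  symm := ⟨fun _ _ h => ⟨h.1.symm, h.2.2, h.2.1⟩⟩
  loopless := ⟨fun _ h => h.1.ne rfl⟩

/-- The barycentric refinement as a graph on the type of simplices. -/
noncomputable def faceGraph (G : FinGraph.{u}) : SimpleGraph G.Simplex := G.barycentric.graph

theorem numAdj_restrictEdges_le {G : FinGraph.{u}} {d : ℕ}
    (hd : ∀ t : G.Simplex, t.verts.card ≤ d + 1) (good : G.Simplex → Prop) :
    numAdj (restrictEdges (faceGraph G) good) ≤
      2 ^ (d + 2) * (Finset.univ.filter good).card := by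
  refine card_le_of_comparable hd good _ fun p hp => ?_
  obtain ⟨h, h1, h2⟩ := (Finset.mem_filter.1 hp).2
  rcases ((barycentric_adj _ _).1 h).2 with h | h
  exacts [Or.inl ⟨h, h2⟩, Or.inr ⟨h, h1⟩]

/-- A lost edge has an end that is not good, so all vertices of that end are bad; in either case the
larger end contains a bad vertex, and it has at most `2 ^ (d+1)` faces. -/
theorem numAdj_le_add {G : FinGraph.{u}} {d : ℕ}
    (hd : ∀ t : G.Simplex, t.verts.card ≤ d + 1) (bad : G.V → Prop) (good : G.Simplex → Prop)
    (hbad : ∀ s : G.Simplex, ¬ good s → ∀ v ∈ s.verts, bad v) :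
    numAdj (faceGraph G) ≤
      numAdj (restrictEdges (faceGraph G) good) +
      2 ^ (d + 2) * (Finset.univ.filter fun t : G.Simplex => t.Touches bad).card := by
  have h := card_le_of_comparable hd (fun t => t.Touches bad)
    ((Finset.univ.filter fun p : G.Simplex × G.Simplex =>
      (faceGraph G).Adj p.1 p.2) \
      (Finset.univ.filter fun p : G.Simplex × G.Simplex =>
        (restrictEdges (faceGraph G) good).Adj p.1 p.2)) (by
      intro p hp
      obtain ⟨hp1, hp2⟩ := Finset.mem_sdiff.1 hp
      have hp1 := (Finset.mem_filter.1 hp1).2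
      have hp2 : ¬ (good p.1 ∧ good p.2) := fun h => hp2 (by simpa using ⟨hp1, h⟩)
      have ht : ∀ s t : G.Simplex, s.verts ⊆ t.verts → ¬ (good s ∧ good t) → t.Touches bad := by
        intro s t hst hg
        obtain ⟨v, hv⟩ := s.nonempty
        refine ⟨v, hst hv, ?_⟩
        rcases not_and_or.1 hg with h | h
        exacts [hbad s h v hv, hbad t h v (hst hv)]
      rcases ((barycentric_adj _ _).1 hp1).2 with h | h
      · exact Or.inl ⟨h, ht _ _ h hp2⟩
      · exact Or.inr ⟨h, ht _ _ h fun h => hp2 h.symm⟩)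
  have h2 := Finset.card_le_card_sdiff_add_card
    (t := Finset.univ.filter fun p : G.Simplex × G.Simplex =>
        (restrictEdges (faceGraph G) good).Adj p.1 p.2)
    (s := Finset.univ.filter fun p : G.Simplex × G.Simplex =>
      (faceGraph G).Adj p.1 p.2)
  rw [numAdj, numAdj]
  omega

end Counting

/-! ### Comparison of a refined graph with copies of the simplex interior -/

section Comparison

open Classical

/-- The complete graph with `d + 1` vertices. -/
noncomputable def stdSimplex (d : ℕ) : FinGraph.{u} := ⟨ULift.{u} (Fin (d + 1)), ⊤⟩

theorem card_stdSimplex (d : ℕ) : Fintype.card (stdSimplex.{u} d).V = d + 1 := by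
  change Fintype.card (ULift.{u} (Fin (d + 1))) = d + 1
  simp

/-- The part of the `k`-th refinement of the complete graph with `d + 1` vertices that does not
lie on its boundary. -/
noncomputable def interior (d k : ℕ) : FinGraph.{u} where
  V := {v : ((stdSimplex.{u} d).iter k).V // (stdSimplex d).supp k v = Finset.univ}
  graph := ((stdSimplex d).iter k).graph.comap Subtype.val

/-- The complete subgraphs with `d + 1` vertices. -/
def Facet (G : FinGraph.{u}) (d : ℕ) : Type u :=
  {s : Finset G.V // G.graph.IsClique (s : Set G.V) ∧ s.card = d + 1}

noncomputable instance (G : FinGraph.{u}) (d : ℕ) : Fintype (G.Facet d) :=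
  inferInstanceAs (Fintype {s : Finset G.V // G.graph.IsClique (s : Set G.V) ∧ s.card = d + 1})

theorem exists_facetEmb (G : FinGraph.{u}) (d : ℕ) (σ : G.Facet d) :
    ∃ f : (stdSimplex.{u} d).graph ↪g G.graph,
      (Finset.univ : Finset (stdSimplex d).V).map f.toEmbedding = σ.1 := by
  have e : (stdSimplex.{u} d).V ≃ {x // x ∈ σ.1} := Fintype.equivOfCardEq (by
    rw [card_stdSimplex, Fintype.card_coe, σ.2.2])
  refine ⟨⟨e.toEmbedding.trans (Function.Embedding.subtype _), ?_⟩, ?_⟩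
  · intro a b
    change G.graph.Adj (e a).1 (e b).1 ↔ a ≠ b
    constructor
    · rintro h rfl
      exact h.ne rfl
    · intro h
      exact σ.2.1 (e a).2 (e b).2 fun h' => h (e.injective (Subtype.ext h'))
  · ext x
    rw [Finset.mem_map]
    constructor
    · rintro ⟨a, _, rfl⟩
      exact (e a).2
    · intro hx
      exact ⟨e.symm ⟨x, hx⟩, Finset.mem_univ _, by
        change (e (e.symm ⟨x, hx⟩)).1 = x
        rw [e.apply_symm_apply]⟩

/-- An embedding of the complete graph onto a facet. -/
noncomputable def facetEmb {G : FinGraph.{u}} {d : ℕ} (σ : G.Facet d) :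
    (stdSimplex.{u} d).graph ↪g G.graph := (exists_facetEmb G d σ).choose

theorem map_facetEmb {G : FinGraph.{u}} {d : ℕ} (σ : G.Facet d) :
    (Finset.univ : Finset (stdSimplex d).V).map (facetEmb σ).toEmbedding = σ.1 :=
  (exists_facetEmb G d σ).choose_spec

/-- The copies of the interior of the refined simplex, followed by the remaining vertices. -/
noncomputable def interiorMap (G : FinGraph.{u}) (d k : ℕ) :
    (G.Facet d × (interior.{u} d k).V) ⊕ {v : (G.iter k).V // (G.supp k v).card ≠ d + 1} →
      (G.iter k).V :=
  Sum.elim (fun p => iterEmb (facetEmb p.1) k p.2.1) Subtype.val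

theorem supp_interiorMap_inl {G : FinGraph.{u}} {d k : ℕ} (σ : G.Facet d)
    (x : (interior.{u} d k).V) : G.supp k (interiorMap G d k (Sum.inl (σ, x))) = σ.1 := by
  change G.supp k (iterEmb (facetEmb σ) k x.1) = σ.1
  rw [supp_iterEmb, x.2, map_facetEmb]

theorem interiorMap_injective (G : FinGraph.{u}) (d k : ℕ) :
    Function.Injective (interiorMap G d k) := by
  rintro (⟨σ, x⟩ | z) (⟨τ, y⟩ | w) h
  · have h1 := congrArg (G.supp k) h
    rw [supp_interiorMap_inl, supp_interiorMap_inl] at h1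
    obtain rfl : σ = τ := Subtype.ext h1
    have h2 : iterEmb (facetEmb σ) k x.1 = iterEmb (facetEmb σ) k y.1 := h
    rw [Subtype.ext ((iterEmb (facetEmb σ) k).injective h2)]
  · refine absurd ?_ w.2
    have h1 := congrArg (G.supp k) h
    rw [supp_interiorMap_inl] at h1
    exact (congrArg Finset.card h1).symm.trans σ.2.2
  · refine absurd ?_ z.2
    have h1 := congrArg (G.supp k) h
    rw [supp_interiorMap_inl] at h1
    exact (congrArg Finset.card h1).trans τ.2.2
  · exact congrArg Sum.inr (Subtype.ext h)

theorem interiorMap_surjective (G : FinGraph.{u}) (d k : ℕ)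
    (hc : ∀ v, G.graph.IsClique (G.supp k v : Set G.V)) :
    Function.Surjective (interiorMap G d k) := by
  intro v
  by_cases hv : (G.supp k v).card = d + 1
  · let σ : G.Facet d := ⟨G.supp k v, hc v, hv⟩
    obtain ⟨x, hx⟩ := exists_iterEmb_eq (facetEmb σ) k v fun y hy => by
      have hy' : y ∈ σ.1 := hy
      rw [← map_facetEmb σ] at hy'
      obtain ⟨a, _, ha⟩ := Finset.mem_map.1 hy'
      exact ⟨a, ha⟩
    have hsupp : (stdSimplex d).supp k x = Finset.univ := by
      apply Finset.map_injective (facetEmb σ).toEmbedding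
      rw [← supp_iterEmb, hx, map_facetEmb]
    exact ⟨Sum.inl (σ, ⟨x, hsupp⟩), hx⟩
  · exact ⟨Sum.inr ⟨v, hv⟩, rfl⟩

/-- A chain of `d + 1` simplices has full support. At level `0` the interior is empty when `d ≥ 1`.
-/
theorem interior_nonempty (d k : ℕ) : Nonempty (interior.{u} d (k + 1)).V := by
  have h0 : 0 < (stdSimplex.{u} d).numSimplices (d + 1) := by
    refine Finset.card_pos.2 ⟨Simplex.mk Finset.univ ?_ ?_, Finset.mem_filter.2
      ⟨Finset.mem_univ _, ?_⟩⟩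
    · exact Finset.card_pos.1 (by rw [Finset.card_univ, card_stdSimplex]; omega)
    · exact fun _ _ _ _ h => h
    · exact Finset.card_univ.trans (card_stdSimplex d)
  have h1 := pow_factorial_le_numSimplices (stdSimplex.{u} d) d k h0
  obtain ⟨t, ht⟩ := Finset.card_pos.1 (lt_of_lt_of_le (pow_pos (Nat.factorial_pos _) _) h1)
  refine ⟨⟨t, ?_⟩⟩
  apply Finset.eq_univ_of_card
  apply le_antisymm (Finset.card_le_univ _)
  rw [card_stdSimplex, ← (Finset.mem_filter.1 ht).2]
  exact (supp_succ_isClique _ k t).2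

theorem card_filter_touches_le (G : FinGraph.{u}) (bad : G.V → Prop) {K : ℕ} (hK : 0 < K) :
    (Finset.univ.filter fun t : G.Simplex => t.Touches bad).card ≤ touchWeight K G bad := by
  rw [touchWeight, Finset.card_filter]
  refine Finset.sum_le_sum fun t _ => ?_
  split_ifs
  · exact Nat.one_le_pow _ _ hK
  · exact le_rfl

/-- The block estimate for the subgraph of edges between vertices of full support, whose blocks are
indexed by the facets of `G`. Lost edges and isolated vertices each contribute at most `2 ^ (d+2)`
times the share of simplices touching a vertex without full support. -/
theorem integral_abs_sub_interior_le {Φ : FinGraph.{u} → Multiset ℝ} (hΦ : IsEdgeMonotone Φ)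
    {G : FinGraph.{u}} {d : ℕ} (hd : G.graph.cliqueNum = d + 1) (k : ℕ) :
    ∫ x in (0 : ℝ)..1, |orderedFunction (Φ (G.iter (k + 1))) x -
        orderedFunction (Φ (interior d (k + 1))) x| ≤
      2 ^ (d + 3) * ((Finset.univ.filter fun t : (G.iter k).Simplex =>
        t.Touches fun v => (G.supp k v).card ≠ d + 1).card : ℝ) /
          Fintype.card (G.iter k).Simplex := by
  have hG : ∀ s : Finset G.V, G.graph.IsClique (s : Set G.V) → s.card ≤ d + 1 := fun s hs =>
    hd ▸ SimpleGraph.IsClique.card_le_cliqueNum (tc := hs)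
  set D := (Finset.univ.filter fun t : (G.iter k).Simplex =>
        t.Touches fun v => (G.supp k v).card ≠ d + 1).card with hD
  let good : (G.iter k).Simplex → Prop := fun s => (G.supp (k + 1) s).card = d + 1
  have hbad : ∀ s : (G.iter k).Simplex, ¬ good s → ∀ v ∈ s.verts, (G.supp k v).card ≠ d + 1 :=
    fun s hs v hv hvd => hs (card_supp_eq_of_subset hG hv hvd)
  have hc := card_verts_le hG k
  let A : SimpleGraph (G.iter (k + 1)).V := restrictEdges (faceGraph (G.iter k)) good
  have hA : A ≤ (G.iter (k + 1)).graph := fun _ _ h => h.1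
  let e := Equiv.ofBijective (interiorMap G d (k + 1)) ⟨interiorMap_injective G d (k + 1),
    interiorMap_surjective G d (k + 1) fun v => (supp_succ_isClique G k v).1⟩
  have hgood : ∀ i x, good (interiorMap G d (k + 1) (Sum.inl (i, x))) := fun i x =>
    (congrArg Finset.card (supp_interiorMap_inl i x)).trans i.2.2
  have : Nonempty (interior.{u} d (k + 1)).V := interior_nonempty d k
  have : Nonempty (G.Facet d) := by
    obtain ⟨s, hs⟩ := G.graph.exists_isNClique_cliqueNum
    exact ⟨⟨s, hs.isClique, hs.card_eq.trans hd⟩⟩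
  have h := integral_abs_sub_le_of_blocks hΦ (interior d (k + 1)) (G.iter (k + 1)) A hA
    (G.Facet d) {v : (G.iter (k + 1)).V // (G.supp (k + 1) v).card ≠ d + 1} e (by
      intro i x j y
      constructor
      · rintro ⟨hadj, -, -⟩
        have h1 := supp_eq_of_adj (k := k + 1) hG hadj (hgood i x) (hgood j y)
        have h2 : i = j := Subtype.ext
          ((supp_interiorMap_inl i x).symm.trans (h1.trans (supp_interiorMap_inl j y)))
        subst h2
        exact ⟨rfl, (iterEmb (facetEmb i) (k + 1)).map_rel_iff.1 hadj⟩
      · rintro ⟨rfl, hadj⟩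
        exact ⟨(iterEmb (facetEmb i) (k + 1)).map_rel_iff.2 hadj, hgood i x, hgood i y⟩)
    (fun z w hzw => z.2 hzw.2.1)
  refine h.trans ?_
  have hcardgood : Fintype.card (G.Facet d) * Fintype.card (interior.{u} d (k + 1)).V =
      (Finset.univ.filter good).card := by
    have h1 : Fintype.card (G.iter (k + 1)).V =
        Fintype.card (G.Facet d) * Fintype.card (interior.{u} d (k + 1)).V +
          Fintype.card {v : (G.iter (k + 1)).V // (G.supp (k + 1) v).card ≠ d + 1} := by
      rw [← Fintype.card_congr e, Fintype.card_sum, Fintype.card_prod]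
    have h2 : Fintype.card {v : (G.iter (k + 1)).V // (G.supp (k + 1) v).card ≠ d + 1} =
        (Finset.univ.filter fun s : (G.iter k).Simplex => ¬ good s).card :=
      Fintype.card_subtype _
    have h3 : (Finset.univ.filter good).card +
        (Finset.univ.filter fun s : (G.iter k).Simplex => ¬ good s).card =
        Fintype.card (G.iter (k + 1)).V := Finset.card_filter_add_card_filter_not _
    omega
  have hz : Fintype.card {v : (G.iter (k + 1)).V // (G.supp (k + 1) v).card ≠ d + 1} ≤ D := by
    have h2 : Fintype.card {v : (G.iter (k + 1)).V // (G.supp (k + 1) v).card ≠ d + 1} =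
        (Finset.univ.filter fun s : (G.iter k).Simplex => ¬ good s).card :=
      Fintype.card_subtype _
    rw [h2]
    refine Finset.card_le_card fun s hs => ?_
    obtain ⟨v, hv⟩ := s.nonempty
    exact Finset.mem_filter.2 ⟨Finset.mem_univ _, v, hv, hbad s (Finset.mem_filter.1 hs).2 v hv⟩
  have hE : numAdj (G.iter (k + 1)).graph ≤ numAdj A + 2 ^ (d + 2) * D :=
    numAdj_le_add hc (fun v => (G.supp k v).card ≠ d + 1) good hbad
  have hE' : numAdj A ≤ 2 ^ (d + 2) *
      (Fintype.card (G.Facet d) * Fintype.card (interior.{u} d (k + 1)).V) := by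
    rw [hcardgood]
    refine (numAdj_restrictEdges_le hc good).trans_eq ?_
    congr!
  have hV : (Fintype.card (G.iter (k + 1)).V : ℝ) = Fintype.card (G.iter k).Simplex := rfl
  have hι : (0 : ℝ) < Fintype.card (G.Facet d) := by exact_mod_cast Fintype.card_pos
  have hR : (0 : ℝ) < Fintype.card (interior.{u} d (k + 1)).V := by
    exact_mod_cast Fintype.card_pos
  have hEr : (numAdj (G.iter (k + 1)).graph : ℝ) - numAdj A ≤ 2 ^ (d + 2) * D := by
    have : (numAdj (G.iter (k + 1)).graph : ℝ) ≤ numAdj A + 2 ^ (d + 2) * D := by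
      exact_mod_cast hE
    linarith
  have hEr' : (numAdj A : ℝ) /
      (Fintype.card (G.Facet d) * Fintype.card (interior.{u} d (k + 1)).V) ≤ 2 ^ (d + 2) := by
    rw [div_le_iff₀ (by positivity)]
    exact_mod_cast hE'
  have hzr : (Fintype.card {v : (G.iter (k + 1)).V // (G.supp (k + 1) v).card ≠ d + 1} : ℝ) ≤
      D := by
    exact_mod_cast hz
  rw [hV]
  calc _ ≤ (2 ^ (d + 2) * D : ℝ) / Fintype.card (G.iter k).Simplex +
        2 ^ (d + 2) * (D / Fintype.card (G.iter k).Simplex) := by gcongr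
    _ = _ := by ring

/-- The rate at which the boundary of a refined simplex becomes negligible. -/
noncomputable def rate (d : ℕ) : ℝ :=
  ((2 * (d + 1).factorial - 1 : ℕ) : ℝ) / (2 * (d + 1).factorial)

theorem rate_nonneg (d : ℕ) : 0 ≤ rate d := by unfold rate; positivity

theorem rate_lt_one (d : ℕ) : rate d < 1 := by
  have h := Nat.factorial_pos (d + 1)
  have h' : (0 : ℝ) < 2 * (d + 1).factorial := by positivity
  rw [rate, div_lt_one h']
  exact_mod_cast (by omega : 2 * (d + 1).factorial - 1 < 2 * (d + 1).factorial)

/-- The numerator grows at most like `((d+1)! - 1/2) ^ k`, the number of vertices at least like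
`(d+1)! ^ k`. The shift by `2` reflects that bad simplices are counted one level below and their
recursion starts at level `1`. -/
theorem exists_integral_abs_sub_interior_le {Φ : FinGraph.{u} → Multiset ℝ}
    (hΦ : IsEdgeMonotone Φ) {G : FinGraph.{u}} {d : ℕ} (hd : G.graph.cliqueNum = d + 1) :
    ∃ C : ℝ, ∀ k, ∫ x in (0 : ℝ)..1, |orderedFunction (Φ (G.iter (k + 2))) x -
        orderedFunction (Φ (interior d (k + 2))) x| ≤ C * rate d ^ k := by
  have hG : ∀ s : Finset G.V, G.graph.IsClique (s : Set G.V) → s.card ≤ d + 1 := fun s hs =>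
    hd ▸ SimpleGraph.IsClique.card_le_cliqueNum (tc := hs)
  refine ⟨2 ^ (d + 3) * touchWeight (2 * 2 ^ 2 ^ (d + 1)) (G.iter 1)
        (fun v => (G.supp 1 v).card ≠ d + 1), fun k => ?_⟩
  refine (integral_abs_sub_interior_le hΦ hd (k + 1)).trans ?_
  have h1 := card_filter_touches_le (G.iter (k + 1)) (fun v => (G.supp (k + 1) v).card ≠ d + 1)
    (K := 2 * 2 ^ 2 ^ (d + 1)) (by positivity)
  have h2 := touchWeight_iter_le hG k
  have h3 : (d + 1).factorial ^ k ≤ Fintype.card (G.iter (k + 1)).Simplex := by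
    refine (Nat.pow_le_pow_right (Nat.factorial_pos _) (Nat.le_succ k)).trans
      ((pow_factorial_le_numSimplices G d (k + 1) (numSimplices_pos hd)).trans ?_)
    exact Finset.card_le_univ _
  generalize touchWeight (2 * 2 ^ 2 ^ (d + 1)) (G.iter (k + 1))
    (fun v => (G.supp (k + 1) v).card ≠ d + 1) = W at h1 h2
  generalize touchWeight (2 * 2 ^ 2 ^ (d + 1)) (G.iter 1)
    (fun v => (G.supp 1 v).card ≠ d + 1) = W1 at h2 ⊢
  generalize (Finset.univ.filter fun t : (G.iter (k + 1)).Simplex =>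
        t.Touches fun v => (G.supp (k + 1) v).card ≠ d + 1).card = D at h1 ⊢
  generalize Fintype.card (G.iter (k + 1)).Simplex = V at h3 ⊢
  have hf : (0 : ℝ) < (d + 1).factorial := by exact_mod_cast Nat.factorial_pos _
  have h4 : (2 : ℝ) ^ k * D ≤ ((2 * (d + 1).factorial - 1 : ℕ) : ℝ) ^ k * W1 := by
    exact_mod_cast (Nat.mul_le_mul_left _ h1).trans h2
  have h5 : ((d + 1).factorial : ℝ) ^ k ≤ V := by exact_mod_cast h3
  rw [rate, div_pow, mul_pow]
  calc (2 : ℝ) ^ (d + 3) * D / V ≤ 2 ^ (d + 3) * D / (d + 1).factorial ^ k := by gcongr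
    _ = 2 ^ (d + 3) * (2 ^ k * D) / (2 ^ k * (d + 1).factorial ^ k) := by
        field_simp
    _ ≤ 2 ^ (d + 3) * (((2 * (d + 1).factorial - 1 : ℕ) : ℝ) ^ k * W1) /
          (2 ^ k * (d + 1).factorial ^ k) := by gcongr
    _ = _ := by ring

end Comparison

/-! ### Eigenvalue monotonicity and Schur majorization -/

section Hermitian

variable {n : Type*} [Fintype n] [DecidableEq n]

theorem dotProduct_mulVec_eq_sum_eigenvalues {A : Matrix n n ℝ} (hA : A.IsHermitian)
    (x : EuclideanSpace ℝ n) :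
    x.ofLp ⬝ᵥ A.mulVec x.ofLp =
      ∑ i, hA.eigenvalues i * (inner ℝ (hA.eigenvectorBasis i) x) ^ 2 := by
  have hs := Matrix.isSymmetric_toEuclideanLin_iff.mpr hA
  have h1 : ∀ i, A.toEuclideanLin (hA.eigenvectorBasis i) =
      hA.eigenvalues i • hA.eigenvectorBasis i := fun i => by
    rw [Matrix.toLpLin_apply, hA.mulVec_eigenvectorBasis]
    rfl
  have h2 : inner ℝ x (A.toEuclideanLin x) = x.ofLp ⬝ᵥ A.mulVec x.ofLp := by
    rw [EuclideanSpace.inner_eq_star_dotProduct, star_trivial, dotProduct_comm,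
      Matrix.toLpLin_apply]
  rw [← h2, ← hA.eigenvectorBasis.sum_inner_mul_inner]
  refine Finset.sum_congr rfl fun i _ => ?_
  rw [← hs, h1, inner_smul_left, real_inner_comm]
  simp only [conj_trivial]
  ring

theorem inner_eigenvectorBasis_eq_zero {A : Matrix n n ℝ} (hA : A.IsHermitian) (S : Set n)
    {x : EuclideanSpace ℝ n} (hx : x ∈ Submodule.span ℝ (hA.eigenvectorBasis '' S)) {i : n}
    (hi : i ∉ S) : inner ℝ (hA.eigenvectorBasis i) x = 0 := by
  have h : Submodule.span ℝ (hA.eigenvectorBasis '' S) ≤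
      LinearMap.ker (innerₛₗ ℝ (hA.eigenvectorBasis i)) := by
    rw [Submodule.span_le]
    rintro _ ⟨j, hj, rfl⟩
    exact hA.eigenvectorBasis.orthonormal.2 fun h => hi (h ▸ hj)
  exact h hx

theorem sum_sq_inner_eigenvectorBasis {A : Matrix n n ℝ} (hA : A.IsHermitian)
    (x : EuclideanSpace ℝ n) : ∑ i, (inner ℝ (hA.eigenvectorBasis i) x) ^ 2 = ‖x‖ ^ 2 := by
  rw [← hA.eigenvectorBasis.sum_sq_norm_inner_right x]
  simp

theorem finrank_span_eigenvectorBasis {A : Matrix n n ℝ} (hA : A.IsHermitian) (S : Finset n) :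
    Module.finrank ℝ (Submodule.span ℝ (hA.eigenvectorBasis '' (S : Set n))) = S.card := by
  have h := finrank_span_eq_card (R := ℝ) (b := fun i : S => hA.eigenvectorBasis i)
    (hA.eigenvectorBasis.orthonormal.linearIndependent.comp _ Subtype.val_injective)
  rw [Fintype.card_coe] at h
  rw [Set.image_eq_range]
  exact h

/-- Monotonicity of eigenvalues: if `A ≤ B` as quadratic forms, then `B` has at most as many
eigenvalues below a given bound as `A`. -/
theorem card_eigenvalues_le_of_le {A B : Matrix n n ℝ} (hA : A.IsHermitian) (hB : B.IsHermitian)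
    (h : ∀ x : n → ℝ, x ⬝ᵥ A.mulVec x ≤ x ⬝ᵥ B.mulVec x) (c : ℝ) :
    (Finset.univ.filter fun i => hB.eigenvalues i ≤ c).card ≤
      (Finset.univ.filter fun i => hA.eigenvalues i ≤ c).card := by
  set S := Finset.univ.filter fun i => hB.eigenvalues i ≤ c with hS
  set T := Finset.univ.filter fun i => ¬ hA.eigenvalues i ≤ c with hT
  -- On the first space the form of `B` is at most `c‖x‖²`, on the second that of `A` exceeds
  -- `c‖x‖²` for `x ≠ 0`. The spaces meet only in `0`, and counting dimensions gives the claim.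
  have hdisj : Disjoint (Submodule.span ℝ (hB.eigenvectorBasis '' (S : Set n)))
      (Submodule.span ℝ (hA.eigenvectorBasis '' (T : Set n))) := by
    rw [Submodule.disjoint_def]
    intro x hxS hxT
    by_contra hx0
    have h1 : x.ofLp ⬝ᵥ B.mulVec x.ofLp ≤ c * ‖x‖ ^ 2 := by
      rw [dotProduct_mulVec_eq_sum_eigenvalues hB, ← sum_sq_inner_eigenvectorBasis hB,
        Finset.mul_sum]
      refine Finset.sum_le_sum fun i _ => ?_
      by_cases hi : i ∈ S
      · exact mul_le_mul_of_nonneg_right (Finset.mem_filter.1 hi).2 (sq_nonneg _)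
      · rw [inner_eigenvectorBasis_eq_zero hB _ hxS hi]
        simp
    have h2 : c * ‖x‖ ^ 2 < x.ofLp ⬝ᵥ A.mulVec x.ofLp := by
      have hle : ∀ i, c * (inner ℝ (hA.eigenvectorBasis i) x) ^ 2 ≤
          hA.eigenvalues i * (inner ℝ (hA.eigenvectorBasis i) x) ^ 2 := fun i => by
        by_cases hi : i ∈ T
        · exact mul_le_mul_of_nonneg_right (not_le.1 (Finset.mem_filter.1 hi).2).le (sq_nonneg _)
        · rw [inner_eigenvectorBasis_eq_zero hA _ hxT hi]
          simp
      rw [dotProduct_mulVec_eq_sum_eigenvalues hA, ← sum_sq_inner_eigenvectorBasis hA,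
        Finset.mul_sum]
      refine Finset.sum_lt_sum (fun i _ => hle i) ?_
      by_contra hcon
      push Not at hcon
      apply hx0
      have hzero : ∀ i, inner ℝ (hA.eigenvectorBasis i) x = 0 := fun i => by
        by_cases hi : i ∈ T
        · by_contra hne
          have hpos : 0 < (inner ℝ (hA.eigenvectorBasis i) x) ^ 2 := by positivity
          exact absurd (hcon i (Finset.mem_univ _))
            (not_le.2 (mul_lt_mul_of_pos_right (not_le.1 (Finset.mem_filter.1 hi).2) hpos))
        · exact inner_eigenvectorBasis_eq_zero hA _ hxT hi
      have h0 := sum_sq_inner_eigenvectorBasis hA x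
      simp only [hzero] at h0
      simpa using h0.symm
    exact absurd (h x.ofLp) (not_le.2 (h1.trans_lt h2))
  have hfin := Submodule.finrank_add_finrank_le_of_disjoint hdisj
  rw [finrank_span_eigenvectorBasis, finrank_span_eigenvectorBasis, finrank_euclideanSpace] at hfin
  have hsplit : (Finset.univ.filter fun i => hA.eigenvalues i ≤ c).card + T.card =
      Fintype.card n := Finset.card_filter_add_card_filter_not _
  omega

/-- Convex functions of the diagonal entries have a sum at most that over the eigenvalues. -/
theorem sum_diag_le_sum_eigenvalues {A : Matrix n n ℝ} (hA : A.IsHermitian) {f : ℝ → ℝ}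
    (hf : ConvexOn ℝ Set.univ f) : ∑ v, f (A v v) ≤ ∑ i, f (hA.eigenvalues i) := by
  -- Squared coordinates of the eigenvectors form a doubly stochastic matrix, and `A v v` is the
  -- corresponding average of the eigenvalues; Jensen then applies row by row.
  set w : n → n → ℝ := fun v i =>
    (inner ℝ (hA.eigenvectorBasis i) (EuclideanSpace.single v (1 : ℝ))) ^ 2 with hw
  have hw1 : ∀ v, ∑ i, w v i = 1 := fun v => by
    rw [hw, sum_sq_inner_eigenvectorBasis]
    simp
  have hw2 : ∀ i, ∑ v, w v i = 1 := fun i => by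
    have h := (EuclideanSpace.basisFun n ℝ).sum_sq_norm_inner_left (hA.eigenvectorBasis i)
    rw [hA.eigenvectorBasis.orthonormal.1 i, one_pow] at h
    rw [← h]
    simp [hw]
  have hd : ∀ v, A v v = ∑ i, w v i • hA.eigenvalues i := fun v => by
    have h := dotProduct_mulVec_eq_sum_eigenvalues hA (EuclideanSpace.single v (1 : ℝ))
    have h2 : (EuclideanSpace.single v (1 : ℝ)).ofLp ⬝ᵥ
        A.mulVec (EuclideanSpace.single v (1 : ℝ)).ofLp = A v v := by simp
    rw [← h2, h]
    exact Finset.sum_congr rfl fun i _ => mul_comm _ _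
  calc ∑ v, f (A v v) ≤ ∑ v, ∑ i, w v i • f (hA.eigenvalues i) := by
        refine Finset.sum_le_sum fun v _ => ?_
        rw [hd v]
        exact hf.map_sum_le (fun i _ => sq_nonneg _) (hw1 v) (fun i _ => Set.mem_univ _)
    _ = ∑ i, f (hA.eigenvalues i) := by
        rw [Finset.sum_comm]
        refine Finset.sum_congr rfl fun i _ => ?_
        rw [← Finset.sum_smul, hw2, one_smul]

end Hermitian

/-! ### Characteristic polynomials of block matrices -/

section Matrices

open Polynomial

theorem charpoly_blockDiagonal {m o : Type*} [Fintype m] [DecidableEq m] [Fintype o]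
    [DecidableEq o] (M : Matrix m m ℝ) :
    (Matrix.blockDiagonal fun _ : o => M).charpoly = M.charpoly ^ Fintype.card o := by
  have h : (Matrix.blockDiagonal fun _ : o => M).charmatrix =
      Matrix.blockDiagonal fun _ : o => M.charmatrix := by
    ext ⟨i, k⟩ ⟨j, l⟩
    rw [Matrix.charmatrix_apply, Matrix.blockDiagonal_apply', Matrix.blockDiagonal_apply',
      Matrix.charmatrix_apply]
    by_cases hkl : k = l
    · subst hkl
      by_cases hij : i = j
      · simp [hij]
      · simp [hij]
    · simp [hkl]
  rw [Matrix.charpoly, h, Matrix.det_blockDiagonal, Finset.prod_const, Finset.card_univ,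
    Matrix.charpoly]

/-- The charpoly of the direct sum of copies of `M` and a zero matrix. -/
theorem charpoly_eq_of_blocks {V m o z : Type*} [Fintype V] [DecidableEq V] [Fintype m]
    [DecidableEq m] [Fintype o] [DecidableEq o] [Fintype z] [DecidableEq z] (L : Matrix V V ℝ)
    (M : Matrix m m ℝ) (e : (o × m) ⊕ z ≃ V)
    (h1 : ∀ i x j y, L (e (Sum.inl (i, x))) (e (Sum.inl (j, y))) = if i = j then M x y else 0)
    (h2 : ∀ c w, L (e (Sum.inr c)) w = 0) (h3 : ∀ c w, L w (e (Sum.inr c)) = 0) :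
    L.charpoly = M.charpoly ^ Fintype.card o * X ^ Fintype.card z := by
  let e' : V ≃ (m × o) ⊕ z := e.symm.trans (Equiv.sumCongr (Equiv.prodComm o m) (Equiv.refl z))
  rw [← Matrix.charpoly_reindex e' L]
  have h : Matrix.reindex e' e' L =
      Matrix.fromBlocks (Matrix.blockDiagonal fun _ : o => M) 0 0 0 := by
    ext (⟨x, i⟩ | c) (⟨y, j⟩ | c')
    · simpa [e', Matrix.blockDiagonal_apply'] using h1 i x j y
    · simpa [e'] using h3 c' _
    · simpa [e'] using h2 c _
    · simpa [e'] using h2 c _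
  rw [h, Matrix.charpoly_fromBlocks_zero₁₂, charpoly_blockDiagonal, Matrix.charpoly_zero]

end Matrices

/-! ### Degrees and Laplacian eigenvalues are edge-monotone -/

section Instances

open Classical

theorem map_univ_eq_of_blocks {V m o z : Type u} [Fintype V] [Fintype m] [Fintype o] [Fintype z]
    (e : (o × m) ⊕ z ≃ V) (f : V → ℝ) (g : m → ℝ)
    (h1 : ∀ i x, f (e (Sum.inl (i, x))) = g x) (h2 : ∀ c, f (e (Sum.inr c)) = 0) :
    (Finset.univ : Finset V).val.map f =
      Fintype.card o • (Finset.univ : Finset m).val.map g +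
        Multiset.replicate (Fintype.card z) 0 := by
  have hsum : ∀ {α : Type u} [Fintype α] (k : α → ℝ),
      (Finset.univ : Finset α).val.map k = ∑ a, ({k a} : Multiset ℝ) := by
    intro α _ k
    rw [Finset.sum_eq_multiset_sum, ← Multiset.sum_map_singleton (Multiset.map k _),
      Multiset.map_map]
    rfl
  rw [hsum f, hsum g, ← e.sum_comp, Fintype.sum_sum_type, Fintype.sum_prod_type]
  simp only [h1, h2, Finset.sum_const, Finset.card_univ, Multiset.nsmul_singleton]

theorem sum_degree_eq_numAdj (G : FinGraph.{u}) :
    ∑ v, (G.graph.degree v : ℝ) = numAdj G.graph := by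
  have h : numAdj G.graph = ∑ v, G.graph.degree v := by
    rw [numAdj, Finset.card_filter, Fintype.sum_prod_type]
    refine Finset.sum_congr rfl fun v _ => ?_
    rw [← G.graph.card_neighborFinset_eq_degree, G.graph.neighborFinset_eq_filter,
      Finset.card_filter]
  rw [h]
  push_cast
  rfl

theorem degree_inl_of_blocks {R G : FinGraph.{u}} {ι Z : Type u} [Fintype ι] [Fintype Z]
    (e : (ι × R.V) ⊕ Z ≃ G.V)
    (h1 : ∀ i x j y, G.graph.Adj (e (Sum.inl (i, x))) (e (Sum.inl (j, y))) ↔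
      i = j ∧ R.graph.Adj x y)
    (h2 : ∀ z w, ¬ G.graph.Adj (e (Sum.inr z)) w) (i : ι) (x : R.V) :
    (G.graph.degree (e (Sum.inl (i, x))) : ℝ) = R.graph.degree x := by
  rw [SimpleGraph.degree_eq_sum_if_adj, SimpleGraph.degree_eq_sum_if_adj, ← e.sum_comp,
    Fintype.sum_sum_type, Fintype.sum_prod_type]
  have h3 : ∀ z, ¬ G.graph.Adj (e (Sum.inl (i, x))) (e (Sum.inr z)) := fun z h => h2 z _ h.symm
  simp only [h1, h3, if_false, Finset.sum_const_zero, add_zero]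
  rw [Finset.sum_eq_single i]
  · simp
  · intro j _ hj
    simp [hj.symm]
  · simp

theorem degree_eq_zero_of_forall_not_adj {G : FinGraph.{u}} {v : G.V}
    (h : ∀ w, ¬ G.graph.Adj v w) : (G.graph.degree v : ℝ) = 0 := by
  rw [SimpleGraph.degree_eq_sum_if_adj]
  simp [h]

theorem isEdgeMonotone_vertexDegrees : IsEdgeMonotone vertexDegrees.{u} where
  card_eq G := by simp [vertexDegrees]
  nonneg G a ha := by
    obtain ⟨v, _, rfl⟩ := Multiset.mem_map.1 ha
    positivity
  sum_eq G := sum_degree_eq_numAdj G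
  mono V _ A B hAB c := by
    rw [vertexDegrees, vertexDegrees, Multiset.countP_map, Multiset.countP_map]
    refine Multiset.card_le_card (Multiset.monotone_filter_right _ fun v hv => ?_)
    refine le_trans ?_ hv
    exact_mod_cast SimpleGraph.degree_le_of_le hAB
  blocks R G ι Z _ _ e h1 h2 := map_univ_eq_of_blocks e _ _ (degree_inl_of_blocks e h1 h2)
    (fun z => degree_eq_zero_of_forall_not_adj (h2 z))

/-- Reduces additivity on disjoint unions to a factorization of the characteristic polynomial. -/
theorem laplaceEigenvalues_eq_roots (G : FinGraph.{u}) :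
    G.laplaceEigenvalues = (G.graph.lapMatrix ℝ).charpoly.roots :=
  ((G.graph.posSemidef_lapMatrix ℝ).isHermitian.roots_charpoly_eq_eigenvalues).symm

theorem lapMatrix_apply {V : Type u} [Fintype V] (A : SimpleGraph V) (v w : V) :
    A.lapMatrix ℝ v w = (if v = w then (A.degree v : ℝ) else 0) - if A.Adj v w then 1 else 0 := by
  rw [SimpleGraph.lapMatrix, Matrix.sub_apply, SimpleGraph.degMatrix, Matrix.diagonal_apply,
    SimpleGraph.adjMatrix_apply]

theorem lapMatrix_apply_self {V : Type u} [Fintype V] (A : SimpleGraph V) (v : V) :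
    A.lapMatrix ℝ v v = A.degree v := by
  rw [lapMatrix_apply]
  simp

/-- The Laplacian form is half a sum of `(x i - x j)²` over adjacent pairs, so new edges only add
squares. -/
theorem dotProduct_lapMatrix_mono {V : Type u} [Fintype V] {A B : SimpleGraph V} (h : A ≤ B)
    (x : V → ℝ) : x ⬝ᵥ (A.lapMatrix ℝ).mulVec x ≤ x ⬝ᵥ (B.lapMatrix ℝ).mulVec x := by
  rw [← Matrix.toLinearMap₂'_apply', ← Matrix.toLinearMap₂'_apply',
    SimpleGraph.lapMatrix_toLinearMap₂', SimpleGraph.lapMatrix_toLinearMap₂']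
  gcongr with i _ j _
  by_cases hA : A.Adj i j
  · rw [if_pos hA, if_pos (h hA)]
  · rw [if_neg hA]
    split_ifs
    exacts [sq_nonneg _, le_rfl]

theorem isEdgeMonotone_laplaceEigenvalues : IsEdgeMonotone laplaceEigenvalues.{u} where
  card_eq G := by simp [laplaceEigenvalues]
  nonneg G a ha := by
    obtain ⟨v, _, rfl⟩ := Multiset.mem_map.1 ha
    exact (G.graph.posSemidef_lapMatrix ℝ).eigenvalues_nonneg v
  sum_eq G := by
    have h := (G.graph.posSemidef_lapMatrix ℝ).isHermitian.trace_eq_sum_eigenvalues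
    rw [← sum_degree_eq_numAdj]
    refine h.symm.trans ?_
    exact Finset.sum_congr rfl fun v _ => lapMatrix_apply_self _ v
  mono V _ A B hAB c := by
    rw [laplaceEigenvalues, laplaceEigenvalues, Multiset.countP_map, Multiset.countP_map]
    exact card_eigenvalues_le_of_le _ _ (dotProduct_lapMatrix_mono hAB) c
  blocks R G ι Z _ _ e h1 h2 := by
    rw [laplaceEigenvalues_eq_roots, laplaceEigenvalues_eq_roots,
      charpoly_eq_of_blocks (G.graph.lapMatrix ℝ) (R.graph.lapMatrix ℝ) e, Polynomial.roots_mul,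
      Polynomial.roots_pow, Polynomial.roots_X_pow, Multiset.nsmul_singleton]
    · exact mul_ne_zero (pow_ne_zero _ (Matrix.charpoly_monic _).ne_zero)
        (pow_ne_zero _ Polynomial.X_ne_zero)
    · intro i x j y
      rw [lapMatrix_apply, lapMatrix_apply, degree_inl_of_blocks e h1 h2]
      by_cases hij : i = j
      · subst hij
        simp [h1]
      · simp [h1, hij]
    · intro c w
      rw [lapMatrix_apply, degree_eq_zero_of_forall_not_adj (h2 c), if_neg (h2 c w)]
      simp
    · intro c w
      have hn : ¬ G.graph.Adj w (e (Sum.inr c)) := fun h => h2 c w h.symm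
      rw [lapMatrix_apply, if_neg hn]
      split_ifs with hw
      · rw [hw, degree_eq_zero_of_forall_not_adj (h2 c), sub_zero]
      · simp

/-- The integrated degree function bounds the integrated spectral function. -/
theorem integral_spectralFunction_le (G : FinGraph.{u}) [Nonempty G.V] {x : ℝ}
    (hx : x ∈ Icc (0 : ℝ) 1) :
    ∫ t in (0 : ℝ)..x, G.spectralFunction t ≤ ∫ t in (0 : ℝ)..x, G.degreeFunction t := by
  have hc1 := isEdgeMonotone_laplaceEigenvalues.card_eq G
  have hc2 := isEdgeMonotone_vertexDegrees.card_eq G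
  have hpos : 0 < Fintype.card G.V := Fintype.card_pos
  refine integral_orderedFunction_le (Multiset.card_pos.1 (by omega))
    (Multiset.card_pos.1 (by omega)) (hc1.trans hc2.symm)
    ((isEdgeMonotone_laplaceEigenvalues.sum_eq G).trans
      (isEdgeMonotone_vertexDegrees.sum_eq G).symm) (fun c => ?_) hx
  have hconv : ConvexOn ℝ Set.univ fun a : ℝ => max (c - a) 0 :=
    ((convexOn_const c convex_univ).sub (concaveOn_id convex_univ)).sup
      (convexOn_const 0 convex_univ)
  have h := sum_diag_le_sum_eigenvalues (G.graph.posSemidef_lapMatrix ℝ).isHermitian hconv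
  rw [vertexDegrees, laplaceEigenvalues, Multiset.map_map, Multiset.map_map]
  refine le_trans (le_of_eq ?_) h
  exact Finset.sum_congr rfl fun v _ => by
    simp only [Function.comp_apply, lapMatrix_apply_self]

theorem integral_spectralFunction_eq (G : FinGraph.{u}) [Nonempty G.V] :
    ∫ t in (0 : ℝ)..1, G.degreeFunction t = ∫ t in (0 : ℝ)..1, G.spectralFunction t := by
  have hc1 := isEdgeMonotone_laplaceEigenvalues.card_eq G
  have hc2 := isEdgeMonotone_vertexDegrees.card_eq G
  have hpos : 0 < Fintype.card G.V := Fintype.card_pos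
  rw [spectralFunction, degreeFunction,
    integral_orderedFunction (Multiset.card_pos.1 (by omega)),
    integral_orderedFunction (Multiset.card_pos.1 (by omega)), hc1, hc2,
    isEdgeMonotone_laplaceEigenvalues.sum_eq G, isEdgeMonotone_vertexDegrees.sum_eq G]

end Instances

end FinGraph

/-! ### Limits in L¹ of monotone functions -/

section Convergence

variable {f : ℕ → ℝ → ℝ} {g : ℝ → ℝ}

theorem ConvergesInL1.congr (h : ConvergesInL1 f g) {g' : ℝ → ℝ}
    (hg : g =ᵐ[volume.restrict (Icc 0 1)] g') : ConvergesInL1 f g' := by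
  refine ⟨h.1, h.2.1.congr hg, h.2.2.congr fun m => eLpNorm_congr_ae ?_⟩
  filter_upwards [hg] with x hx
  simp [hx]

theorem ConvergesInL1.tendsto_integral (h : ConvergesInL1 f g) {a b : ℝ} (ha : 0 ≤ a)
    (hab : a ≤ b) (hb : b ≤ 1) :
    Tendsto (fun m => ∫ t in a..b, f m t) atTop (𝓝 (∫ t in a..b, g t)) := by
  have hsub : Ioc a b ⊆ Icc (0 : ℝ) 1 := fun t ht => ⟨ha.trans ht.1.le, ht.2.trans hb⟩
  have key := tendsto_setIntegral_of_L1' g h.2.1.aestronglyMeasurable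
    (Eventually.of_forall h.1) h.2.2 (Ioc a b)
  simpa only [Measure.restrict_restrict_of_subset hsub,
    ← intervalIntegral.integral_of_le hab] using key

theorem ConvergesInL1.intervalIntegrable (h : ConvergesInL1 f g) {a b : ℝ} (ha : 0 ≤ a)
    (hab : a ≤ b) (hb : b ≤ 1) (m : ℕ) : IntervalIntegrable (f m) volume a b := by
  rw [intervalIntegrable_iff_integrableOn_Icc_of_le hab]
  exact (h.1 m).mono_set (Icc_subset_Icc ha hb)

theorem ConvergesInL1.intervalIntegrable_limit (h : ConvergesInL1 f g) {a b : ℝ} (ha : 0 ≤ a)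
    (hab : a ≤ b) (hb : b ≤ 1) : IntervalIntegrable g volume a b := by
  rw [intervalIntegrable_iff_integrableOn_Icc_of_le hab]
  exact h.2.1.mono_set (Icc_subset_Icc ha hb)

/-- Monotone functions converging in `L¹` converge at the continuity points of the limit. -/
theorem ConvergesInL1.tendsto_of_continuousAt (h : ConvergesInL1 f g)
    (hf : ∀ m, MonotoneOn (f m) (Ioo 0 1)) {x : ℝ} (hx : x ∈ Ioo (0 : ℝ) 1)
    (hg : ContinuousAt g x) : Tendsto (fun m => f m x) atTop (𝓝 (g x)) := by
  rw [Metric.tendsto_atTop']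
  intro ε hε
  obtain ⟨δ, hδ, hgδ⟩ := Metric.continuousAt_iff.1 hg (ε / 2) (half_pos hε)
  obtain ⟨η, hη, h0, h1, hηδ⟩ : ∃ η, 0 < η ∧ 0 < x - η ∧ x + η < 1 ∧ η < δ := by
    refine ⟨min (min x (1 - x)) δ / 2, ?_, ?_, ?_, ?_⟩
    all_goals
      have h2 : 0 < min (min x (1 - x)) δ := lt_min (lt_min hx.1 (by linarith [hx.2])) hδ
      have h3 : min (min x (1 - x)) δ ≤ min x (1 - x) := min_le_left _ _
      have h4 := min_le_left x (1 - x)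
      have h5 := min_le_right x (1 - x)
      have h6 : min (min x (1 - x)) δ ≤ δ := min_le_right _ _
      linarith [hx.1, hx.2]
  have hup : ∀ t ∈ Icc x (x + η), g t ≤ g x + ε / 2 := fun t ht => by
    have := hgδ (x := t) (by rw [Real.dist_eq, abs_lt]; constructor <;> linarith [ht.1, ht.2])
    rw [Real.dist_eq, abs_lt] at this
    linarith
  have hdown : ∀ t ∈ Icc (x - η) x, g x - ε / 2 ≤ g t := fun t ht => by
    have := hgδ (x := t) (by rw [Real.dist_eq, abs_lt]; constructor <;> linarith [ht.1, ht.2])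
    rw [Real.dist_eq, abs_lt] at this
    linarith
  have i1 : ∫ t in x..(x + η), g t ≤ η * (g x + ε / 2) := by
    have := intervalIntegral.integral_mono_on (by linarith)
      (h.intervalIntegrable_limit hx.1.le (by linarith) h1.le)
      (intervalIntegrable_const (c := g x + ε / 2)) hup
    rw [intervalIntegral.integral_const, add_sub_cancel_left, smul_eq_mul] at this
    exact this
  have i2 : η * (g x - ε / 2) ≤ ∫ t in (x - η)..x, g t := by
    have := intervalIntegral.integral_mono_on (by linarith)
      (intervalIntegrable_const (c := g x - ε / 2))
      (h.intervalIntegrable_limit h0.le (by linarith) hx.2.le) hdown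
    rw [intervalIntegral.integral_const, sub_sub_cancel, smul_eq_mul] at this
    exact this
  -- By monotonicity `f m x` lies between the averages of `f m` over `[x - η, x]` and `[x, x + η]`,
  -- and these converge to averages of `g`, which are within `ε / 2` of `g x`.
  have e1 := (h.tendsto_integral hx.1.le (by linarith) h1.le).eventually_lt_const
    (show _ < η * (g x + ε) by nlinarith)
  have e2 := (h.tendsto_integral h0.le (by linarith : x - η ≤ x) hx.2.le).eventually_const_lt
    (show η * (g x - ε) < _ by nlinarith)
  obtain ⟨N, hN⟩ := eventually_atTop.1 (e1.and e2)
  refine ⟨N, fun m hm => ?_⟩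
  obtain ⟨h3, h4⟩ := hN m (le_of_lt hm)
  have j1 : η * f m x ≤ ∫ t in x..(x + η), f m t := by
    have := intervalIntegral.integral_mono_on (by linarith)
      (intervalIntegrable_const (c := f m x))
      (h.intervalIntegrable hx.1.le (by linarith) h1.le m) (fun t ht => hf m hx
        ⟨by linarith [ht.1, hx.1], by linarith [ht.2]⟩ ht.1)
    simpa using this
  have j2 : ∫ t in (x - η)..x, f m t ≤ η * f m x := by
    have := intervalIntegral.integral_mono_on (by linarith)
      (h.intervalIntegrable h0.le (by linarith) hx.2.le m)
      (intervalIntegrable_const (c := f m x)) (fun t ht => hf m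
        ⟨by linarith [ht.1], by linarith [ht.2, hx.2]⟩ hx ht.2)
    simpa using this
  rw [Real.dist_eq, abs_lt]
  have k1 := lt_of_mul_lt_mul_left (j1.trans_lt h3) hη.le
  have k2 := lt_of_mul_lt_mul_left (h4.trans_le j2) hη.le
  constructor <;> linarith

theorem exists_mem_Ioo_of_ae {P : ℝ → Prop} (hP : ∀ᵐ x ∂volume.restrict (Icc (0 : ℝ) 1), P x)
    {a b : ℝ} (ha : 0 ≤ a) (hab : a < b) (hb : b ≤ 1) : ∃ y ∈ Ioo a b, P y := by
  by_contra hcon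
  push Not at hcon
  have h1 : Ioo a b ⊆ {x | ¬ P x} := hcon
  have h2 : volume.restrict (Icc (0 : ℝ) 1) (Ioo a b) = 0 := measure_mono_null h1 hP
  have hsub : Ioo a b ⊆ Icc 0 1 := fun t ht => ⟨ha.trans ht.1.le, ht.2.le.trans hb⟩
  rw [Measure.restrict_apply measurableSet_Ioo, inter_eq_left.2 hsub, Real.volume_Ioo] at h2
  simp only [ENNReal.ofReal_eq_zero] at h2
  linarith

/-- The `L¹` limit of monotone functions has a monotone representative. -/
theorem ConvergesInL1.exists_monotoneOn (h : ConvergesInL1 f g)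
    (hf : ∀ m, MonotoneOn (f m) (Ioo 0 1)) :
    ∃ g', MonotoneOn g' (Ioo 0 1) ∧ g =ᵐ[volume.restrict (Icc 0 1)] g' := by
  obtain ⟨ns, -, hns⟩ := (tendstoInMeasure_of_tendsto_eLpNorm one_ne_zero
    (fun m => (h.1 m).aestronglyMeasurable) h.2.1.aestronglyMeasurable
    h.2.2).exists_seq_tendsto_ae
  -- On the points where a subsequence converges, `g` is itself monotone; the supremum over such
  -- points to the left extends it monotonically and returns `g` on `D`, which is almost everything.
  set D : Set ℝ := {y | y ∈ Ioo (0 : ℝ) 1 ∧ Tendsto (fun i => f (ns i) y) atTop (𝓝 (g y))} with hD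
  have hmono : ∀ y ∈ D, ∀ z ∈ D, y ≤ z → g y ≤ g z := fun y hy z hz hyz =>
    le_of_tendsto_of_tendsto' hy.2 hz.2 fun i => hf (ns i) hy.1 hz.1 hyz
  have hbdd : ∀ x ∈ Ioo (0 : ℝ) 1, BddAbove (g '' (D ∩ Iic x)) := by
    intro x hx
    obtain ⟨z, hz, hzt⟩ := exists_mem_Ioo_of_ae hns hx.1.le hx.2 le_rfl
    refine ⟨g z, ?_⟩
    rintro _ ⟨y, ⟨hy, hyx⟩, rfl⟩
    exact hmono y hy z ⟨⟨hx.1.trans hz.1, hz.2⟩, hzt⟩ (le_trans hyx hz.1.le)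
  have hne : ∀ x ∈ Ioo (0 : ℝ) 1, (g '' (D ∩ Iic x)).Nonempty := by
    intro x hx
    obtain ⟨z, hz, hzt⟩ := exists_mem_Ioo_of_ae hns le_rfl hx.1 hx.2.le
    exact ⟨g z, z, ⟨⟨⟨hz.1, hz.2.trans hx.2⟩, hzt⟩, hz.2.le⟩, rfl⟩
  refine ⟨fun x => sSup (g '' (D ∩ Iic x)), fun x hx y hy hxy => ?_, ?_⟩
  · exact csSup_le_csSup (hbdd y hy) (hne x hx)
      (image_mono (inter_subset_inter_right _ (Iic_subset_Iic.2 hxy)))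
  · have h0 : ∀ᵐ x ∂volume.restrict (Icc (0 : ℝ) 1), x ≠ 0 :=
      ae_restrict_of_ae (by simp [ae_iff])
    have h1 : ∀ᵐ x ∂volume.restrict (Icc (0 : ℝ) 1), x ≠ 1 :=
      ae_restrict_of_ae (by simp [ae_iff])
    filter_upwards [hns, h0, h1, ae_restrict_mem measurableSet_Icc] with x hx hx0 hx1 hxI
    have hxD : x ∈ D := ⟨⟨lt_of_le_of_ne hxI.1 hx0.symm, lt_of_le_of_ne hxI.2 hx1⟩, hx⟩
    have hgreat : IsGreatest (g '' (D ∩ Iic x)) (g x) := by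
      refine ⟨⟨x, ⟨hxD, le_refl x⟩, rfl⟩, ?_⟩
      rintro _ ⟨y, ⟨hy, hyx⟩, rfl⟩
      exact hmono y hy x hxD hyx
    exact hgreat.csSup_eq.symm

theorem eLpNorm_sub_eq_ofReal_integral {p q : ℝ → ℝ} (hp : IntegrableOn p (Icc 0 1))
    (hq : IntegrableOn q (Icc 0 1)) :
    eLpNorm (p - q) 1 (volume.restrict (Icc 0 1)) =
      ENNReal.ofReal (∫ x in (0 : ℝ)..1, |p x - q x|) := by
  rw [eLpNorm_one_eq_lintegral_enorm, ← ofReal_integral_norm_eq_lintegral_enorm (hp.sub hq),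
    intervalIntegral.integral_of_le zero_le_one, integral_Icc_eq_integral_Ioc]
  rfl

/-- A sequence with geometrically decreasing `L¹` increments converges in `L¹`. -/
theorem exists_convergesInL1_of_le_geometric {r C : ℝ} (hr : r < 1)
    (hf : ∀ m, IntegrableOn (f m) (Icc 0 1))
    (h : ∀ m, ∫ x in (0 : ℝ)..1, |f m x - f (m + 1) x| ≤ C * r ^ m) :
    ∃ g, ConvergesInL1 f g := by
  have hm : ∀ m, MemLp (f m) 1 (volume.restrict (Icc 0 1)) := fun m =>
    memLp_one_iff_integrable.2 (hf m)
  have hc : CauchySeq fun m => (hm m).toLp (f m) := by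
    refine cauchySeq_of_le_geometric r C hr fun m => ?_
    rw [dist_edist, Lp.edist_toLp_toLp, eLpNorm_sub_eq_ofReal_integral (hf m) (hf (m + 1)),
      ENNReal.toReal_ofReal
        (intervalIntegral.integral_nonneg zero_le_one fun _ _ => abs_nonneg _)]
    exact h m
  obtain ⟨g, hg⟩ := cauchySeq_tendsto_of_complete hc
  have hgm := Lp.memLp g
  refine ⟨g, hf, memLp_one_iff_integrable.1 hgm, ?_⟩
  rw [← Lp.tendsto_Lp_iff_tendsto_eLpNorm'' f hm g hgm, Lp.toLp_coeFn]
  exact hg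

end Convergence

/-! ### The universal limit -/

namespace FinGraph

theorem integrableOn_orderedFunction (s : Multiset ℝ) :
    IntegrableOn (orderedFunction s) (Icc 0 1) :=
  integrableOn_comp_orderedFunction s id 0 1

theorem cliqueNum_stdSimplex (d : ℕ) : (stdSimplex.{u} d).graph.cliqueNum = d + 1 := by
  apply le_antisymm
  · obtain ⟨s, hs⟩ := (stdSimplex.{u} d).graph.exists_isNClique_cliqueNum
    rw [← hs.card_eq, ← card_stdSimplex.{u} d]
    exact Finset.card_le_univ s
  · rw [← card_stdSimplex.{u} d, ← Finset.card_univ]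
    exact SimpleGraph.IsClique.card_le_cliqueNum (tc := fun _ _ _ _ h => h)

theorem card_le_of_isClique {G : FinGraph.{u}} {d : ℕ} (h : G.graph.cliqueNum = d + 1)
    (s : Finset G.V) (hs : G.graph.IsClique (s : Set G.V)) : s.card ≤ d + 1 :=
  h ▸ SimpleGraph.IsClique.card_le_cliqueNum (tc := hs)

theorem nonempty_of_cliqueNum {G : FinGraph.{u}} {d : ℕ} (h : G.graph.cliqueNum = d + 1) :
    Nonempty G.V := by
  obtain ⟨s, hs⟩ := G.graph.exists_isNClique_cliqueNum
  obtain ⟨v, _⟩ := Finset.card_pos.1 (show 0 < s.card by rw [hs.card_eq]; omega)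
  exact ⟨v⟩

/-- The ordered functions of iterated refinements have an `L¹` limit depending only on the
dimension. -/
theorem exists_convergesInL1 {Φ : FinGraph.{u} → Multiset ℝ} (hΦ : IsEdgeMonotone Φ) (d : ℕ) :
    ∃ F : ℝ → ℝ, ∀ G : FinGraph.{u}, G.graph.cliqueNum = d + 1 →
      ConvergesInL1 (fun m => orderedFunction (Φ (G.refinement m))) F := by
  have hstd := cliqueNum_stdSimplex.{u} d
  obtain ⟨C₀, h₀⟩ := exists_integral_abs_sub_interior_le hΦ hstd
  -- Refining the simplex once more shifts its sequence by one, so `interior d (k + 2)` and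
  -- `interior d (k + 3)` are both close to the same graph, the refinement of the simplex at level
  -- `k + 3`.
  obtain ⟨C₁, h₁⟩ := exists_integral_abs_sub_interior_le hΦ
    (G := (stdSimplex.{u} d).barycentric) (cliqueNum_iter (card_le_of_isClique hstd) 1 hstd)
  have hi : ∀ s t : Multiset ℝ, IntervalIntegrable
      (fun x => |orderedFunction s x - orderedFunction t x|) volume 0 1 := fun s t =>
    ((intervalIntegrable_orderedFunction s 0 1).sub
      (intervalIntegrable_orderedFunction t 0 1)).abs
  obtain ⟨F, hF⟩ := exists_convergesInL1_of_le_geometric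
    (f := fun k => orderedFunction (Φ (interior d (k + 2)))) (r := rate d) (C := C₁ + C₀ * rate d)
    (rate_lt_one d) (fun k => integrableOn_orderedFunction _) (fun k => by
      have h2 := h₀ (k + 1)
      have h3 := h₁ k
      rw [iter_barycentric] at h3
      calc ∫ x in (0 : ℝ)..1, |orderedFunction (Φ (interior d (k + 2))) x -
            orderedFunction (Φ (interior d (k + 1 + 2))) x|
          ≤ ∫ x in (0 : ℝ)..1, (|orderedFunction (Φ ((stdSimplex d).iter (k + 2 + 1))) x -
              orderedFunction (Φ (interior d (k + 2))) x| +
            |orderedFunction (Φ ((stdSimplex d).iter (k + 1 + 2))) x -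
              orderedFunction (Φ (interior d (k + 1 + 2))) x|) := by
            apply intervalIntegral.integral_mono_on zero_le_one (hi _ _) ((hi _ _).add (hi _ _))
            intro x _
            rw [abs_sub_comm (orderedFunction (Φ ((stdSimplex d).iter (k + 2 + 1))) x)]
            exact abs_sub_le _ _ _
        _ ≤ C₁ * rate d ^ k + C₀ * rate d ^ (k + 1) := by
            rw [intervalIntegral.integral_add (hi _ _) (hi _ _)]
            exact add_le_add h3 h2
        _ = _ := by ring)
  refine ⟨F, fun G hG => ⟨fun m => integrableOn_orderedFunction _, hF.2.1, ?_⟩⟩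
  obtain ⟨C, hC⟩ := exists_integral_abs_sub_interior_le hΦ hG
  rw [← tendsto_add_atTop_iff_nat 2]
  have hlim : Tendsto (fun k => ENNReal.ofReal (C * rate d ^ k) +
      eLpNorm ((fun k => orderedFunction (Φ (interior.{u} d (k + 2)))) k - F) 1
        (volume.restrict (Icc 0 1))) atTop (𝓝 0) := by
    have h1 : Tendsto (fun k => ENNReal.ofReal (C * rate d ^ k)) atTop (𝓝 0) := by
      have := ((tendsto_pow_atTop_nhds_zero_of_lt_one (rate_nonneg d)
        (rate_lt_one d)).const_mul C)
      rw [mul_zero] at this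
      simpa using ENNReal.tendsto_ofReal this
    simpa using h1.add hF.2.2
  refine tendsto_of_tendsto_of_tendsto_of_le_of_le tendsto_const_nhds hlim (fun _ => zero_le)
    fun k => ?_
  have hsub : orderedFunction (Φ (G.refinement (k + 2))) - F =
      (orderedFunction (Φ (G.refinement (k + 2))) - orderedFunction (Φ (interior d (k + 2)))) +
        (orderedFunction (Φ (interior d (k + 2))) - F) := by abel
  change eLpNorm (orderedFunction (Φ (G.refinement (k + 2))) - F) 1 _ ≤ _
  rw [hsub]
  refine (eLpNorm_add_le ((integrableOn_orderedFunction _).sub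
    (integrableOn_orderedFunction _)).aestronglyMeasurable
    ((integrableOn_orderedFunction _).sub hF.2.1).aestronglyMeasurable le_rfl).trans ?_
  gcongr
  rw [eLpNorm_sub_eq_ofReal_integral (integrableOn_orderedFunction _)
    (integrableOn_orderedFunction _), refinement_eq_iter]
  exact ENNReal.ofReal_le_ofReal (hC k)

end FinGraph

theorem mainTheorem6 (d : ℕ) :
    ∃ F H : ℝ → ℝ,
      (∀ G : FinGraph.{u}, G.graph.cliqueNum = d + 1 →
        ConvergesInL1 (fun m => (G.refinement m).spectralFunction) F ∧
        ConvergesInL1 (fun m => (G.refinement m).degreeFunction) H ∧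
        (∀ x ∈ Ioo (0 : ℝ) 1, ContinuousAt H x →
          Tendsto (fun m => (G.refinement m).degreeFunction x) atTop (𝓝 (H x)))) ∧
      MonotoneOn H (Ioo 0 1) ∧
      (∀ x ∈ Icc (0 : ℝ) 1, (∫ t in (0 : ℝ)..x, F t) ≤ (∫ t in (0 : ℝ)..x, H t)) ∧
      (∫ t in (0 : ℝ)..0, H t) = (∫ t in (0 : ℝ)..0, F t) ∧
      (∫ t in (0 : ℝ)..1, H t) = (∫ t in (0 : ℝ)..1, F t) := by
  obtain ⟨F, hF⟩ := FinGraph.exists_convergesInL1 FinGraph.isEdgeMonotone_laplaceEigenvalues.{u} d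
  obtain ⟨H₀, hH₀⟩ := FinGraph.exists_convergesInL1 FinGraph.isEdgeMonotone_vertexDegrees.{u} d
  have hne : ∀ G : FinGraph.{u}, G.graph.cliqueNum = d + 1 → ∀ m, Nonempty (G.refinement m).V :=
    fun G hG m => by
      rw [FinGraph.refinement_eq_iter]
      exact FinGraph.nonempty_of_cliqueNum
        (FinGraph.cliqueNum_iter (FinGraph.card_le_of_isClique hG) m hG)
  have hmono : ∀ G : FinGraph.{u}, G.graph.cliqueNum = d + 1 → ∀ m,
      MonotoneOn (FinGraph.orderedFunction (G.refinement m).vertexDegrees) (Ioo 0 1) :=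
    fun G hG m => by
    have := hne G hG m
    refine (FinGraph.orderedFunction_mono (Multiset.card_pos.1 ?_)).mono Ioo_subset_Ico_self
    rw [FinGraph.isEdgeMonotone_vertexDegrees.card_eq]
    exact Fintype.card_pos
  have hstd := FinGraph.cliqueNum_stdSimplex.{u} d
  -- The limit is determined only almost everywhere; the monotone representative found from the
  -- simplex remains the L¹ limit for every other `G`.
  obtain ⟨H, hHmono, hH⟩ := (hH₀ _ hstd).exists_monotoneOn (hmono _ hstd)
  have hconv := fun G hG => (hH₀ G hG).congr hH
  refine ⟨F, H, fun G hG => ⟨hF G hG, hconv G hG, fun x hx hc =>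
    (hconv G hG).tendsto_of_continuousAt (hmono G hG) hx hc⟩, hHmono, fun x hx => ?_, by simp, ?_⟩
  · refine le_of_tendsto_of_tendsto' ((hF _ hstd).tendsto_integral le_rfl hx.1 hx.2)
      ((hconv _ hstd).tendsto_integral le_rfl hx.1 hx.2) fun m => ?_
    have := hne _ hstd m
    exact FinGraph.integral_spectralFunction_le _ hx
  · refine tendsto_nhds_unique ((hconv _ hstd).tendsto_integral le_rfl zero_le_one le_rfl)
      (((hF _ hstd).tendsto_integral le_rfl zero_le_one le_rfl).congr fun m => ?_)
    have := hne _ hstd m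
    exact (FinGraph.integral_spectralFunction_eq ((FinGraph.stdSimplex d).refinement m)).symm
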